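/- For integers $n,p\ge 1$ and $z\in\mathbb{C}\setminus(1,\infty)$ let \[ S_{n,p}(z)=\frac{(-1)^{n+p-1}}{(n-1)!\,p!}\int_0^1 \log^{n-1}(t)\,\log^{p}(1-zt)\,\frac{dt}{t} \] (principal branch of the logarithm) be the Nielsen polylogarithm, let $\mathrm{Li}_m(z)=\sum_{k\ge 1} z^k/k^m$ for $m\ge 2$, $|z|\le 1$ be the classical polylogarithm, and let $\zeta$ be the Riemann zeta function. Then: (1) \[ S_{3,3}(-1)=\frac32\,S_{4,2}(-1)+\frac{5}{16}\,\zeta(6)-\frac14\,\zeta(3)^2 . \] (2) With $\omega=e^{2\pi i/6}$, \[ S_{3,3}(\omega)=3\,\mathrm{Li}_6(\omega)-\frac12\,\zeta(3)^2-\frac{1829}{1944}\,\zeta(6)+\frac13\, i\pi\,\bigl(S_{3,2}(\omega)-2\,\zeta(5)\bigr)+\frac13\,\zeta(2)\,\mathrm{Li}_4(\omega)+\frac{1}{324}\,(2 i\pi)^3\,\zeta(3). \] -/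

import Mathlib

/-- The classical polylogarithm `Li_m(z) = ∑_{k ≥ 1} z^k / k^m`, given by its power series, which
converges absolutely for `‖z‖ ≤ 1` when `m ≥ 2` (the sum is indexed by `k = j + 1`, `j ≥ 0`). -/
noncomputable def classicalPolylog (m : ℕ) (z : ℂ) : ℂ :=
  ∑' j : ℕ, z ^ (j + 1) / ((j + 1 : ℕ) : ℂ) ^ m

/-- Nielsen's generalised polylogarithm, for `n, p ≥ 1` and `z` outside the cut `(1, ∞)`:
`S_{n,p}(z) = (-1)^(n+p-1) / ((n-1)! p!) * ∫_0^1 log^(n-1)(t) log^p(1 - z t) dt / t`,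
with the principal branch of the logarithm. -/
noncomputable def nielsenPolylog (n p : ℕ) (z : ℂ) : ℂ :=
  (-1 : ℂ) ^ (n + p - 1) / (((n - 1).factorial : ℂ) * (p.factorial : ℂ)) *
    ∫ t in (0 : ℝ)..1, (Real.log t : ℂ) ^ (n - 1) * Complex.log (1 - z * (t : ℂ)) ^ p / (t : ℂ)

/-!
Let `ω = exp (πi / 3)`, `A = log x - πi / 3` and `B = log (1 - x) + πi / 3`. The Möbius map
`x ↦ 1 / (1 - x)` of order three fixes `ω`, cycles `0`, `1`, `∞` and acts on the logarithms by
`(A, B) ↦ (-B, A - B)`, while on the segment `[0, ω]` the logarithm `A` is real. Cauchy's theorem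
expresses the integral of `A ^ i * B ^ j / x` (made regular at `0`) over `[0, 1]` through the
integrals over `[0, ω]` and over the arc from `ω` to `1`, and the Möbius map turns the arc back into
`[0, ω]`. Both sides expand into Nielsen polylogarithms, at `1` and at `ω`. One combination of these
identities loses every term at `ω` and yields `S_{3,3}(1)`; another yields `S_{3,3}(ω)`. The other
values at `1` needed are zeta values and `S_{n,2}(1)`, which is Euler's evaluation of the double
series `∑ 1 / (k m (k + m) ^ n)`.

At `-1`, the substitution `s = 1 / (1 + t)` folds an integral over `[0, 1]` of a polynomial
symmetric in `log s` and `log (1 - s)` into Nielsen integrals at `-1`, so that `S_{3,3}(-1)` reduces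
to `S_{4,2}(-1)`, `Li_6(-1)` and the values at `1`.
-/

open MeasureTheory Set Filter Topology Asymptotics

/-- `f` is integrable on the open unit interval with integral `v`. -/
def HasUnitIntegral (f : ℝ → ℂ) (v : ℂ) : Prop :=
  IntegrableOn f (Ioo 0 1) ∧ ∫ t in Ioo (0 : ℝ) 1, f t = v

namespace HasUnitIntegral

variable {f g : ℝ → ℂ} {v w : ℂ}

theorem of_integrableOn (hf : IntegrableOn f (Ioo 0 1)) :
    HasUnitIntegral f (∫ t in Ioo (0 : ℝ) 1, f t) := ⟨hf, rfl⟩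

theorem of_intervalIntegral (hf : IntegrableOn f (Ioo 0 1)) (h : ∫ t in (0 : ℝ)..1, f t = v) :
    HasUnitIntegral f v := by
  refine ⟨hf, ?_⟩
  rw [← h, intervalIntegral.integral_of_le zero_le_one, integral_Ioc_eq_integral_Ioo]

theorem unique (hf : HasUnitIntegral f v) (hg : HasUnitIntegral f w) : v = w :=
  hf.2.symm.trans hg.2

theorem congr (hf : HasUnitIntegral f v) (h : ∀ t ∈ Ioo (0 : ℝ) 1, g t = f t) :
    HasUnitIntegral g v :=
  ⟨hf.1.congr_fun (fun t ht => (h t ht).symm) measurableSet_Ioo,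
    (setIntegral_congr_fun measurableSet_Ioo h).trans hf.2⟩

theorem add (hf : HasUnitIntegral f v) (hg : HasUnitIntegral g w) :
    HasUnitIntegral (fun t => f t + g t) (v + w) :=
  ⟨hf.1.add hg.1, by rw [integral_add hf.1 hg.1, hf.2, hg.2]⟩

theorem const_mul (hf : HasUnitIntegral f v) (c : ℂ) :
    HasUnitIntegral (fun t => c * f t) (c * v) :=
  ⟨hf.1.const_mul c, by rw [integral_const_mul, hf.2]⟩

theorem sub (hf : HasUnitIntegral f v) (hg : HasUnitIntegral g w) :
    HasUnitIntegral (fun t => f t - g t) (v - w) :=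
  ⟨hf.1.sub hg.1, by rw [integral_sub hf.1 hg.1, hf.2, hg.2]⟩

theorem sum {ι : Type*} (s : Finset ι) {f : ι → ℝ → ℂ} {v : ι → ℂ}
    (hf : ∀ i ∈ s, HasUnitIntegral (f i) (v i)) :
    HasUnitIntegral (fun t => ∑ i ∈ s, f i t) (∑ i ∈ s, v i) :=
  ⟨integrable_finsetSum s fun i hi => (hf i hi).1, by
    rw [integral_finsetSum s fun i hi => (hf i hi).1]
    exact Finset.sum_congr rfl fun i hi => (hf i hi).2⟩

theorem intervalIntegrable (hf : HasUnitIntegral f v) : IntervalIntegrable f volume 0 1 := by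
  rw [intervalIntegrable_iff_integrableOn_Ioo_of_le zero_le_one]
  exact hf.1

theorem intervalIntegral (hf : HasUnitIntegral f v) : ∫ t in (0 : ℝ)..1, f t = v := by
  rw [intervalIntegral.integral_of_le zero_le_one, integral_Ioc_eq_integral_Ioo, hf.2]

theorem of_hasDerivAt {F : ℝ → ℂ} (hF : ∀ t ∈ Ioo (0 : ℝ) 1, HasDerivAt F (f t) t)
    (hf : IntegrableOn f (Ioo 0 1)) (h0 : Tendsto F (𝓝[>] 0) (𝓝 v))
    (h1 : Tendsto F (𝓝[<] 1) (𝓝 w)) : HasUnitIntegral f (w - v) :=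
  .of_intervalIntegral hf <| intervalIntegral.integral_eq_sub_of_hasDerivAt_of_tendsto
    zero_lt_one hF (of_integrableOn hf).intervalIntegrable h0 h1

theorem comp_one_sub (hf : HasUnitIntegral f v) : HasUnitIntegral (fun t => f (1 - t)) v := by
  refine of_intervalIntegral ?_ ?_
  · rw [← intervalIntegrable_iff_integrableOn_Ioo_of_le zero_le_one]
    simpa using (hf.intervalIntegrable.comp_sub_left 1).symm
  · rw [intervalIntegral.integral_comp_sub_left f 1]
    simpa using hf.intervalIntegral

end HasUnitIntegral

theorem one_sub_mem_Ioo_zero_one {t : ℝ} (ht : t ∈ Ioo (0 : ℝ) 1) : 1 - t ∈ Ioo (0 : ℝ) 1 :=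
  ⟨sub_pos.2 ht.2, sub_lt_self 1 ht.1⟩

theorem tendsto_one_sub_nhdsLT_one : Tendsto (fun t : ℝ => 1 - t) (𝓝[<] 1) (𝓝[>] 0) := by
  refine tendsto_nhdsWithin_iff.2 ⟨?_, eventually_mem_nhdsWithin.mono fun t ht => ?_⟩
  · have : Tendsto (fun t : ℝ => 1 - t) (𝓝 1) (𝓝 (1 - 1)) := Continuous.tendsto (by fun_prop) 1
    exact (sub_self (1 : ℝ) ▸ this).mono_left nhdsWithin_le_nhds
  · exact sub_pos.2 (mem_Iio.1 ht)

/-- `f` grows on the unit interval more slowly than every negative power of `t (1 - t)`, as all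
polynomials in `log t` and `log (1 - t)` do. -/
def HasSubpowerGrowth (f : ℝ → ℂ) : Prop :=
  ∀ δ : ℝ, 0 < δ → f =O[𝓟 (Ioo 0 1)] fun t => (t * (1 - t)) ^ (-δ)

namespace HasSubpowerGrowth

variable {f g : ℝ → ℂ}

theorem of_norm_le (hg : HasSubpowerGrowth g) (h : ∀ t ∈ Ioo (0 : ℝ) 1, ‖f t‖ ≤ ‖g t‖) :
    HasSubpowerGrowth f :=
  fun δ hδ => (IsBigO.of_norm_eventuallyLE (eventually_principal.2 h)).trans (hg δ hδ).norm_left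

theorem const (c : ℂ) : HasSubpowerGrowth fun _ => c := by
  refine fun δ hδ => IsBigO.of_bound ‖c‖ (eventually_principal.2 fun t ht => ?_)
  have ht' := one_sub_mem_Ioo_zero_one ht
  refine le_mul_of_one_le_right (norm_nonneg c) (le_trans ?_ (le_abs_self _))
  exact Real.one_le_rpow_of_pos_of_le_one_of_nonpos (mul_pos ht.1 ht'.1)
    (mul_le_one₀ ht.2.le ht'.1.le ht'.2.le) (by linarith)

theorem add (hf : HasSubpowerGrowth f) (hg : HasSubpowerGrowth g) :
    HasSubpowerGrowth fun t => f t + g t :=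
  fun δ hδ => (hf δ hδ).add (hg δ hδ)

theorem sub (hf : HasSubpowerGrowth f) (hg : HasSubpowerGrowth g) :
    HasSubpowerGrowth fun t => f t - g t :=
  fun δ hδ => (hf δ hδ).sub (hg δ hδ)

theorem mul (hf : HasSubpowerGrowth f) (hg : HasSubpowerGrowth g) :
    HasSubpowerGrowth fun t => f t * g t := by
  intro δ hδ
  refine ((hf _ (half_pos hδ)).mul (hg _ (half_pos hδ))).congr' .rfl
    (eventually_principal.2 fun t ht => ?_)
  beta_reduce
  rw [← Real.rpow_add (mul_pos ht.1 (one_sub_mem_Ioo_zero_one ht).1)]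
  congr 1
  ring

theorem pow (hf : HasSubpowerGrowth f) (n : ℕ) : HasSubpowerGrowth fun t => f t ^ n := by
  induction n with
  | zero => simpa only [pow_zero] using const 1
  | succ n ih => simpa only [pow_succ] using ih.mul hf

theorem sum {ι : Type*} (s : Finset ι) {f : ι → ℝ → ℂ} (hf : ∀ i ∈ s, HasSubpowerGrowth (f i)) :
    HasSubpowerGrowth fun t => ∑ i ∈ s, f i t :=
  fun δ hδ => IsBigO.fun_sum fun i hi => hf i hi δ hδ

theorem comp_one_sub (hf : HasSubpowerGrowth f) : HasSubpowerGrowth fun t => f (1 - t) := by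
  intro δ hδ
  have hmaps : Tendsto (fun t : ℝ => 1 - t) (𝓟 (Ioo 0 1)) (𝓟 (Ioo 0 1)) :=
    tendsto_principal_principal.2 fun _ => one_sub_mem_Ioo_zero_one
  refine ((hf δ hδ).comp_tendsto hmaps).congr_right fun t => ?_
  simp only [Function.comp_apply, sub_sub_cancel, mul_comm]

protected theorem integrableOn (hf : HasSubpowerGrowth f) (hm : Measurable f) :
    IntegrableOn f (Ioo 0 1) := by
  obtain ⟨C, hC⟩ := (hf (1 / 2) one_half_pos).bound
  have hbeta := Complex.betaIntegral_convergent (u := 1 / 2) (v := 1 / 2) (by norm_num)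
    (by norm_num)
  rw [intervalIntegrable_iff_integrableOn_Ioo_of_le zero_le_one] at hbeta
  refine (hbeta.norm.const_mul C).mono' hm.aestronglyMeasurable ?_
  filter_upwards [ae_restrict_mem measurableSet_Ioo] with t ht
  refine (eventually_principal.1 hC t ht).trans_eq ?_
  have ht' := one_sub_mem_Ioo_zero_one ht
  rw [norm_mul, ← Complex.ofReal_one, ← Complex.ofReal_sub,
    Complex.norm_cpow_eq_rpow_re_of_pos ht.1, Complex.norm_cpow_eq_rpow_re_of_pos ht'.1,
    Real.norm_of_nonneg (Real.rpow_nonneg (mul_pos ht.1 ht'.1).le _),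
    Real.mul_rpow ht.1.le ht'.1.le]
  norm_num

theorem tendsto_ofReal_mul (hf : HasSubpowerGrowth f) :
    Tendsto (fun t : ℝ => t * f t) (𝓝[>] 0) (𝓝 0) := by
  have hpow : Tendsto (fun t : ℝ => t ^ (1 / 2 : ℝ) * (1 - t) ^ (-(1 / 2) : ℝ)) (𝓝[>] 0)
      (𝓝 0) := by
    have h : ContinuousAt (fun t : ℝ => t ^ (1 / 2 : ℝ) * (1 - t) ^ (-(1 / 2) : ℝ)) 0 :=
      (Real.continuousAt_rpow_const _ _ (by norm_num)).mul
        (ContinuousAt.rpow_const (by fun_prop) (by norm_num))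
    simpa using h.tendsto.mono_left nhdsWithin_le_nhds
  have hid : (fun t : ℝ => (t : ℂ)) =O[𝓟 (Ioo 0 1)] fun t : ℝ => t :=
    isBigO_of_le _ fun t => (Complex.norm_real t).le
  refine IsBigO.trans_tendsto (((hid.mul (hf _ one_half_pos)).mono
    (le_principal_iff.2 (Ioo_mem_nhdsGT zero_lt_one))).congr' .rfl ?_) hpow
  filter_upwards [Ioo_mem_nhdsGT zero_lt_one] with t ht
  rw [Real.mul_rpow ht.1.le (one_sub_mem_Ioo_zero_one ht).1.le, ← mul_assoc]
  nth_rw 1 [← Real.rpow_one t]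
  rw [← Real.rpow_add ht.1]
  norm_num

theorem tendsto_one_sub_mul (hf : HasSubpowerGrowth f) :
    Tendsto (fun t : ℝ => (1 - t) * f t) (𝓝[<] 1) (𝓝 0) := by
  simpa [Function.comp_def] using
    hf.comp_one_sub.tendsto_ofReal_mul.comp tendsto_one_sub_nhdsLT_one

end HasSubpowerGrowth

section LogGrowth

variable {z : ℂ} {t : ℝ}

theorem hasSubpowerGrowth_log : HasSubpowerGrowth fun t => (Real.log t : ℂ) := by
  refine fun δ hδ => IsBigO.of_bound δ⁻¹ (eventually_principal.2 fun t ht => ?_)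
  have ht' := one_sub_mem_Ioo_zero_one ht
  have hpos := mul_pos ht.1 ht'.1
  rw [Complex.norm_real, Real.norm_of_nonpos (Real.log_nonpos ht.1.le ht.2.le),
    Real.norm_of_nonneg (Real.rpow_nonneg hpos.le _), ← Real.log_inv, inv_mul_eq_div]
  calc Real.log t⁻¹ ≤ t⁻¹ ^ δ / δ := Real.log_le_rpow_div (inv_nonneg.2 ht.1.le) hδ
    _ ≤ (t * (1 - t)) ^ (-δ) / δ := by
      rw [Real.inv_rpow ht.1.le, ← Real.rpow_neg ht.1.le]
      gcongr ?_ / δ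
      exact Real.rpow_le_rpow_of_nonpos hpos (mul_le_of_le_one_right ht.1.le ht'.2.le)
        (neg_nonpos.2 hδ.le)

theorem norm_mul_ofReal_le (hz : ‖z‖ ≤ 1) (ht : t ∈ Ioo (0 : ℝ) 1) : ‖z * t‖ ≤ t := by
  rw [norm_mul, Complex.norm_real, Real.norm_of_nonneg ht.1.le]
  exact mul_le_of_le_one_left ht.1.le hz

theorem norm_log_one_sub_mul_le (hz : ‖z‖ ≤ 1) (ht : t ∈ Ioo (0 : ℝ) 1) :
    ‖Complex.log (1 - z * t)‖ ≤ -Real.log (1 - t) := by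
  have hzt := norm_mul_ofReal_le hz ht
  have hreal := Real.hasSum_pow_div_log_of_abs_lt_one (abs_lt.2 ⟨by linarith [ht.1], ht.2⟩)
  have hcomplex := Complex.hasSum_taylorSeries_neg_log (hzt.trans_lt ht.2)
  rw [← hasSum_nat_add_iff' 1] at hcomplex
  simp only [Finset.range_one, Finset.sum_singleton, Nat.cast_zero, div_zero, sub_zero]
    at hcomplex
  rw [← norm_neg, ← hcomplex.tsum_eq]
  refine tsum_of_norm_bounded hreal fun n => ?_
  rw [norm_div, norm_pow, Complex.norm_natCast, Nat.cast_succ]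
  gcongr

theorem hasSubpowerGrowth_log_one_sub_mul (hz : ‖z‖ ≤ 1) :
    HasSubpowerGrowth fun t => Complex.log (1 - z * t) := by
  refine hasSubpowerGrowth_log.comp_one_sub.of_norm_le fun t ht => ?_
  rw [Complex.norm_real]
  exact (norm_log_one_sub_mul_le hz ht).trans (neg_le_abs _)

theorem neg_log_one_sub_le_mul (ht : t < 1) :
    -Real.log (1 - t) ≤ t * (1 - Real.log (1 - t)) := by
  have ht' : 0 < 1 - t := sub_pos.2 ht
  have h := Real.one_sub_inv_le_log_of_pos ht'
  have : (1 - t) * (1 - t)⁻¹ = 1 := mul_inv_cancel₀ ht'.ne'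
  nlinarith

theorem hasSubpowerGrowth_log_one_sub_mul_div (hz : ‖z‖ ≤ 1) :
    HasSubpowerGrowth fun t => Complex.log (1 - z * t) / t := by
  refine ((HasSubpowerGrowth.const 1).sub hasSubpowerGrowth_log.comp_one_sub).of_norm_le
    fun t ht => ?_
  rw [norm_div, Complex.norm_real, Real.norm_of_nonneg ht.1.le, div_le_iff₀' ht.1,
    ← Complex.ofReal_one, ← Complex.ofReal_sub, Complex.norm_real]
  calc ‖Complex.log (1 - z * t)‖ ≤ -Real.log (1 - t) := norm_log_one_sub_mul_le hz ht
    _ ≤ t * (1 - Real.log (1 - t)) := neg_log_one_sub_le_mul ht.2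
    _ ≤ t * ‖1 - Real.log (1 - t)‖ := mul_le_mul_of_nonneg_left (le_abs_self _) ht.1.le

theorem hasSubpowerGrowth_log_div_one_sub :
    HasSubpowerGrowth fun t => (Real.log t : ℂ) / (1 - t) := by
  refine (hasSubpowerGrowth_log_one_sub_mul_div norm_one.le).comp_one_sub.of_norm_le
    fun t ht => le_of_eq ?_
  rw [Complex.ofReal_log ht.1.le]
  push_cast
  rw [one_mul, sub_sub_cancel]

theorem hasSubpowerGrowth_log_mul_div_one_sub_mul (hz : ‖z‖ ≤ 1) :
    HasSubpowerGrowth fun t => (Real.log t : ℂ) * (z / (1 - z * t)) := by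
  refine hasSubpowerGrowth_log_div_one_sub.of_norm_le fun t ht => ?_
  have ht' := (one_sub_mem_Ioo_zero_one ht).1
  have hle : 1 - t ≤ ‖1 - z * t‖ := by
    have := norm_sub_norm_le (1 : ℂ) (z * t)
    rw [norm_one] at this
    linarith [norm_mul_ofReal_le hz ht]
  rw [norm_mul, norm_div, norm_div, ← Complex.ofReal_one, ← Complex.ofReal_sub,
    Complex.norm_real (1 - t), Real.norm_of_nonneg ht'.le, div_eq_mul_one_div _ (1 - t),
    Complex.ofReal_one]
  gcongr

theorem half_le_re_one_sub_mul (hr : z.re ≤ 1 / 2) (ht : t ∈ Icc (0 : ℝ) 1) :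
    1 / 2 ≤ (1 - z * t).re := by
  have : (1 - z * t).re = 1 - z.re * t := by simp
  nlinarith [ht.1, ht.2]

theorem hasSubpowerGrowth_div_one_sub_mul (hr : z.re ≤ 1 / 2) :
    HasSubpowerGrowth fun t => z / (1 - z * t) := by
  refine (HasSubpowerGrowth.const (2 * z)).of_norm_le fun t ht => ?_
  have h := (half_le_re_one_sub_mul hr (Ioo_subset_Icc_self ht)).trans (Complex.re_le_norm _)
  rw [norm_div, norm_mul, Complex.norm_ofNat, div_le_iff₀ (by linarith)]
  nlinarith [norm_nonneg z]

theorem one_sub_mul_mem_slitPlane (hz : ‖z‖ ≤ 1) (ht : t ∈ Ioo (0 : ℝ) 1) :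
    1 - z * t ∈ Complex.slitPlane := by
  refine Or.inl ?_
  rw [Complex.sub_re, Complex.one_re]
  linarith [Complex.re_le_norm (z * t), norm_mul_ofReal_le hz ht, ht.2]

theorem hasDerivAt_log_one_sub_mul (h : 1 - z * t ∈ Complex.slitPlane) :
    HasDerivAt (fun t : ℝ => Complex.log (1 - z * t)) (-z / (1 - z * t)) t := by
  have h1 : HasDerivAt (fun t : ℝ => 1 - z * (t : ℂ)) (-z) t := by
    simpa using ((Complex.ofRealCLM.hasDerivAt (x := t)).const_mul z).const_sub 1
  exact h1.clog_real h

end LogGrowth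

section NielsenIntegrals

variable {z : ℂ}

theorem hasUnitIntegral_nielsenPolylog (hz : ‖z‖ ≤ 1) (i j : ℕ) :
    HasUnitIntegral
      (fun t => (Real.log t : ℂ) ^ i * Complex.log (1 - z * t) ^ (j + 1) / t)
      ((-1) ^ (i + j + 1) * i.factorial * (j + 1).factorial *
        nielsenPolylog (i + 1) (j + 1) z) := by
  have hgrowth := ((hasSubpowerGrowth_log.pow i).mul
    ((hasSubpowerGrowth_log_one_sub_mul hz).pow j)).mul (hasSubpowerGrowth_log_one_sub_mul_div hz)
  have hint : HasUnitIntegral _ _ := .of_integrableOn <| (hgrowth.of_norm_le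
    (f := fun t => (Real.log t : ℂ) ^ i * Complex.log (1 - z * t) ^ (j + 1) / t)
    fun t _ => le_of_eq (by ring_nf)).integrableOn (by fun_prop)
  convert hint using 1
  rw [nielsenPolylog, ← hint.intervalIntegral, Nat.add_sub_cancel,
    show i + 1 + (j + 1) - 1 = i + j + 1 by omega]
  have hi : (i.factorial : ℂ) ≠ 0 := Nat.cast_ne_zero.2 i.factorial_ne_zero
  have hj : ((j + 1).factorial : ℂ) ≠ 0 := Nat.cast_ne_zero.2 (j + 1).factorial_ne_zero
  field_simp
  rw [pow_right_comm, neg_one_sq, one_pow, one_mul]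

/-- The Nielsen integral with its logarithms shifted by constants,
`∫₀¹ (log t + α)ⁱ ((log (1 - z t) + β)ʲ - βʲ) dt / t`; subtracting `βʲ` makes it converge at `0`.
Such integrals appear when the branches of the logarithms change under a Möbius substitution. -/
noncomputable def shiftedNielsen (z α β : ℂ) (i j : ℕ) : ℂ :=
  ∫ t in Ioo (0 : ℝ) 1,
    ((Real.log t : ℂ) + α) ^ i * ((Complex.log (1 - z * t) + β) ^ j - β ^ j) / t

theorem hasSubpowerGrowth_shiftedNielsen (hz : ‖z‖ ≤ 1) (α β : ℂ) (i j : ℕ) :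
    HasSubpowerGrowth fun t =>
      ((Real.log t : ℂ) + α) ^ i * ((Complex.log (1 - z * t) + β) ^ j - β ^ j) / t := by
  have hsum : HasSubpowerGrowth fun t => ∑ k ∈ Finset.range j,
      (Complex.log (1 - z * t) + β) ^ k * β ^ (j - 1 - k) :=
    .sum _ fun k _ => (((hasSubpowerGrowth_log_one_sub_mul hz).add (.const β)).pow k).mul
      (.const _)
  refine ((((hasSubpowerGrowth_log.add (.const α)).pow i).mul hsum).mul
    (hasSubpowerGrowth_log_one_sub_mul_div hz)).of_norm_le fun t _ => le_of_eq ?_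
  rw [← (Commute.all _ _).geom_sum₂_mul, add_sub_cancel_right, mul_assoc,
    mul_div_assoc, mul_div_assoc]

theorem hasUnitIntegral_shiftedNielsen (hz : ‖z‖ ≤ 1) (α β : ℂ) (i j : ℕ) :
    HasUnitIntegral
      (fun t => ((Real.log t : ℂ) + α) ^ i * ((Complex.log (1 - z * t) + β) ^ j - β ^ j) / t)
      (shiftedNielsen z α β i j) :=
  .of_integrableOn ((hasSubpowerGrowth_shiftedNielsen hz α β i j).integrableOn (by fun_prop))

theorem shiftedNielsen_eq_sum (hz : ‖z‖ ≤ 1) (α β : ℂ) (i j : ℕ) :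
    shiftedNielsen z α β i j = ∑ k ∈ Finset.range (i + 1), ∑ l ∈ Finset.range j,
      (i.choose k * α ^ (i - k)) * (j.choose (l + 1) * β ^ (j - (l + 1))) *
        ((-1) ^ (k + l + 1) * k.factorial * (l + 1).factorial *
          nielsenPolylog (k + 1) (l + 1) z) := by
  refine (hasUnitIntegral_shiftedNielsen hz α β i j).unique
    ((HasUnitIntegral.sum _ fun k _ => .sum _ fun l _ =>
      (hasUnitIntegral_nielsenPolylog hz k l).const_mul _).congr fun t _ => ?_)
  rw [add_pow, add_pow, Finset.sum_range_succ' _ j, pow_zero, one_mul, Nat.sub_zero,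
    Nat.choose_zero_right, Nat.cast_one, mul_one, add_sub_cancel_right, Finset.sum_mul_sum,
    Finset.sum_div]
  refine Finset.sum_congr rfl fun k _ => ?_
  rw [Finset.sum_div]
  exact Finset.sum_congr rfl fun l _ => by ring

theorem hasDerivAt_log_pow_mul_log_one_sub_mul_pow_sub {t : ℝ} (ht : t ≠ 0)
    (h : 1 - z * t ∈ Complex.slitPlane) (β : ℂ) (m n : ℕ) :
    HasDerivAt
      (fun t : ℝ => (Real.log t : ℂ) ^ (m + 1) *
        ((Complex.log (1 - z * t) + β) ^ (n + 1) - β ^ (n + 1)))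
      ((m + 1) * (((Real.log t : ℂ) + 0) ^ m *
          ((Complex.log (1 - z * t) + β) ^ (n + 1) - β ^ (n + 1)) / t) -
        (n + 1) * ((Real.log t : ℂ) ^ (m + 1) * (Complex.log (1 - z * t) + β) ^ n *
          (z / (1 - z * t)))) t := by
  refine (((Real.hasDerivAt_log ht).ofReal_comp.pow (m + 1)).mul
    (((hasDerivAt_log_one_sub_mul h).add_const β).pow (n + 1) |>.sub_const _)).congr_deriv ?_
  simp only [Pi.pow_apply, Nat.add_sub_cancel]
  push_cast
  ring

theorem hasUnitIntegral_log_pow_succ_mul_dlog (hz : ‖z‖ ≤ 1) (β : ℂ) (m n : ℕ) :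
    HasUnitIntegral
      (fun t => (Real.log t : ℂ) ^ (m + 1) * (Complex.log (1 - z * t) + β) ^ n *
        (z / (1 - z * t)))
      ((m + 1) / (n + 1) * shiftedNielsen z 0 β m (n + 1)) := by
  have hL := hasSubpowerGrowth_log_one_sub_mul hz
  have hdlog := HasUnitIntegral.of_integrableOn <|
    ((((hasSubpowerGrowth_log.pow m).mul ((hL.add (.const β)).pow n)).mul
      (hasSubpowerGrowth_log_mul_div_one_sub_mul hz)).of_norm_le
    (f := fun t => (Real.log t : ℂ) ^ (m + 1) * (Complex.log (1 - z * t) + β) ^ n *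
        (z / (1 - z * t))) fun t _ => le_of_eq (by ring_nf)).integrableOn (by fun_prop)
  have hderiv := ((hasUnitIntegral_shiftedNielsen hz 0 β m (n + 1)).const_mul (m + 1)).sub
    (hdlog.const_mul (n + 1))
  have h0 := (hasSubpowerGrowth_shiftedNielsen hz 0 β (m + 1) (n + 1)).tendsto_ofReal_mul
  have h1 := (((hasSubpowerGrowth_log.pow m).mul
    (((hL.add (.const β)).pow (n + 1)).sub (.const (β ^ (n + 1))))).mul
      hasSubpowerGrowth_log_div_one_sub).tendsto_one_sub_mul
  have hparts := hderiv.unique <| .of_hasDerivAt (fun t ht =>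
      hasDerivAt_log_pow_mul_log_one_sub_mul_pow_sub ht.1.ne' (one_sub_mul_mem_slitPlane hz ht)
        β m n) hderiv.1
    (h0.congr' (eventually_mem_nhdsWithin.mono fun t ht => by
      rw [add_zero, mul_div_cancel₀ _ (Complex.ofReal_ne_zero.2 (mem_Ioi.1 ht).ne')]))
    (h1.congr' (eventually_mem_nhdsWithin.mono fun t ht => by
      have : (1 - t : ℂ) ≠ 0 := mod_cast (sub_pos.2 (mem_Iio.1 ht)).ne'
      field_simp
      ring))
  convert hdlog using 1
  have : (n + 1 : ℂ) ≠ 0 := n.cast_add_one_ne_zero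
  rw [div_mul_eq_mul_div, div_eq_iff this]
  linear_combination hparts

theorem hasUnitIntegral_log_one_sub_mul_pow_mul_dlog (hz : ‖z‖ ≤ 1) (hr : z.re ≤ 1 / 2) (β : ℂ)
    (n : ℕ) :
    HasUnitIntegral (fun t => (Complex.log (1 - z * t) + β) ^ n * (z / (1 - z * t)))
      ((β ^ (n + 1) - (Complex.log (1 - z) + β) ^ (n + 1)) / (n + 1)) := by
  have hint : IntegrableOn (fun t : ℝ => (Complex.log (1 - z * t) + β) ^ n *
      (z / (1 - z * t))) (Ioo 0 1) :=
    ((((hasSubpowerGrowth_log_one_sub_mul hz).add (.const β)).pow n).mul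
      (hasSubpowerGrowth_div_one_sub_mul hr)).integrableOn (by fun_prop)
  have hderiv : ∀ t ∈ Icc (0 : ℝ) 1, HasDerivAt
      (fun t : ℝ => -(Complex.log (1 - z * t) + β) ^ (n + 1) / (n + 1))
      ((Complex.log (1 - z * t) + β) ^ n * (z / (1 - z * t))) t := by
    intro t ht
    have hslit : 1 - z * t ∈ Complex.slitPlane :=
      Or.inl (by linarith [half_le_re_one_sub_mul hr ht])
    refine (((hasDerivAt_log_one_sub_mul hslit).add_const β).pow (n + 1)
      |>.neg.div_const (n + 1 : ℂ)).congr_deriv ?_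
    have : (n + 1 : ℂ) ≠ 0 := n.cast_add_one_ne_zero
    rw [Nat.add_sub_cancel, Nat.cast_add_one]
    field_simp
  convert HasUnitIntegral.of_hasDerivAt (fun t ht => hderiv t (Ioo_subset_Icc_self ht)) hint
    ((hderiv 0 (by simp)).continuousAt.tendsto.mono_left nhdsWithin_le_nhds)
    ((hderiv 1 (by simp)).continuousAt.tendsto.mono_left nhdsWithin_le_nhds) using 1
  simp only [Complex.ofReal_zero, mul_zero, sub_zero, Complex.log_one, Complex.ofReal_one, mul_one,
    zero_add]
  ring

theorem nielsenPolylog_one_symm (i j : ℕ) :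
    nielsenPolylog (i + 1) (j + 1) 1 = nielsenPolylog (j + 1) (i + 1) 1 := by
  have hshift : shiftedNielsen 1 0 0 i (j + 1) = (-1) ^ (i + j + 1) * i.factorial *
      (j + 1).factorial * nielsenPolylog (i + 1) (j + 1) 1 := by
    refine (hasUnitIntegral_shiftedNielsen norm_one.le 0 0 i (j + 1)).unique
      ((hasUnitIntegral_nielsenPolylog norm_one.le i j).congr fun t _ => ?_)
    rw [add_zero, add_zero, zero_pow j.succ_ne_zero, sub_zero]
  have hparts := (hasUnitIntegral_log_pow_succ_mul_dlog norm_one.le 0 i j).comp_one_sub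
  have h := (hparts.congr (g := fun t => (Real.log t : ℂ) ^ j *
    Complex.log (1 - 1 * t) ^ (i + 1) / t) fun t ht => ?_).unique
      (hasUnitIntegral_nielsenPolylog norm_one.le j i)
  · rw [hshift, Nat.factorial_succ i, Nat.factorial_succ j, add_comm j i] at h
    have hj := j.cast_add_one_ne_zero (R := ℂ)
    push_cast at h
    field_simp at h
    exact mul_left_cancel₀ (mul_ne_zero (Nat.cast_ne_zero.2 i.factorial_ne_zero)
      (Nat.cast_ne_zero.2 j.factorial_ne_zero)) h
  · rw [Complex.ofReal_log ht.1.le, Complex.ofReal_log (one_sub_mem_Ioo_zero_one ht).1.le]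
    push_cast
    rw [one_mul, one_mul, sub_sub_cancel, add_zero]
    ring

end NielsenIntegrals

section PowerSeries

theorem hasSubpowerGrowth_ofReal_pow (k : ℕ) : HasSubpowerGrowth fun t => (t : ℂ) ^ k := by
  refine (HasSubpowerGrowth.const 1).of_norm_le fun t ht => ?_
  rw [norm_pow, Complex.norm_real, Real.norm_of_nonneg ht.1.le, norm_one]
  exact pow_le_one₀ ht.1.le ht.2.le

theorem integrableOn_log_pow_mul_pow (n k : ℕ) :
    IntegrableOn (fun t : ℝ => (Real.log t : ℂ) ^ n * (t : ℂ) ^ k) (Ioo 0 1) :=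
  ((hasSubpowerGrowth_log.pow n).mul (hasSubpowerGrowth_ofReal_pow k)).integrableOn (by fun_prop)

theorem hasDerivAt_log_pow_succ_mul_pow_succ {t : ℝ} (ht : t ≠ 0) (n k : ℕ) :
    HasDerivAt (fun t : ℝ => (Real.log t : ℂ) ^ (n + 1) * (t : ℂ) ^ (k + 1))
      ((n + 1) * ((Real.log t : ℂ) ^ n * t ^ k) +
        (k + 1) * ((Real.log t : ℂ) ^ (n + 1) * t ^ k)) t := by
  refine (((Real.hasDerivAt_log ht).ofReal_comp.pow (n + 1)).mul
    ((Complex.ofRealCLM.hasDerivAt (x := t)).pow (k + 1))).congr_deriv ?_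
  have : (t : ℂ) ≠ 0 := Complex.ofReal_ne_zero.2 ht
  simp only [Pi.pow_apply, Nat.add_sub_cancel, Complex.ofRealCLM_apply, Complex.ofReal_one]
  push_cast
  field_simp
  ring

theorem hasUnitIntegral_log_pow_mul_pow (n k : ℕ) :
    HasUnitIntegral (fun t : ℝ => (Real.log t : ℂ) ^ n * (t : ℂ) ^ k)
      ((-1) ^ n * n.factorial / (k + 1) ^ (n + 1)) := by
  have hk : (k : ℂ) + 1 ≠ 0 := k.cast_add_one_ne_zero
  induction n with
  | zero =>
    refine .of_intervalIntegral (integrableOn_log_pow_mul_pow 0 k) ?_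
    simp only [pow_zero, one_mul, ← Complex.ofReal_pow]
    rw [intervalIntegral.integral_ofReal, integral_pow]
    simp
  | succ n ih =>
    have hint := HasUnitIntegral.of_integrableOn (integrableOn_log_pow_mul_pow (n + 1) k)
    have hderiv := (ih.const_mul (n + 1)).add (hint.const_mul (k + 1))
    have h0 : Tendsto (fun t : ℝ => (Real.log t : ℂ) ^ (n + 1) * (t : ℂ) ^ (k + 1)) (𝓝[>] 0)
        (𝓝 0) :=
      ((hasSubpowerGrowth_log.pow (n + 1)).mul
        (hasSubpowerGrowth_ofReal_pow k)).tendsto_ofReal_mul.congr fun t => by ring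
    have h1 : Tendsto (fun t : ℝ => (Real.log t : ℂ) ^ (n + 1) * (t : ℂ) ^ (k + 1)) (𝓝[<] 1)
        (𝓝 0) := by
      have := (hasDerivAt_log_pow_succ_mul_pow_succ one_ne_zero n k).continuousAt.tendsto
      simpa using this.mono_left nhdsWithin_le_nhds
    have hparts := hderiv.unique <| .of_hasDerivAt
      (fun t ht => hasDerivAt_log_pow_succ_mul_pow_succ ht.1.ne' n k) hderiv.1 h0 h1
    convert hint using 1
    rw [Nat.factorial_succ]
    push_cast
    field_simp at hparts ⊢
    linear_combination -hparts

theorem integral_norm_const_mul_log_pow_mul_pow (c : ℂ) (n k : ℕ) :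
    ∫ t in Ioo (0 : ℝ) 1, ‖c * ((Real.log t : ℂ) ^ n * (t : ℂ) ^ k)‖ =
      ‖c‖ * (n.factorial / (k + 1) ^ (n + 1)) := by
  have h := ((hasUnitIntegral_log_pow_mul_pow n k).const_mul ((-1) ^ n * ‖c‖)).congr
    (g := fun t : ℝ => ((‖c * ((Real.log t : ℂ) ^ n * (t : ℂ) ^ k)‖ : ℝ) : ℂ)) fun t ht => by
      rw [norm_mul, norm_mul, norm_pow, norm_pow, Complex.norm_of_nonneg ht.1.le,
        Complex.norm_real, Real.norm_of_nonpos (Real.log_nonpos ht.1.le ht.2.le), neg_pow]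
      push_cast
      ring
  have hsign : ((-1 : ℂ) ^ n) * (-1) ^ n = 1 := by rw [← mul_pow]; simp
  refine Complex.ofReal_injective (integral_ofReal.symm.trans (h.2.trans ?_))
  push_cast
  linear_combination (‖c‖ * (n.factorial / (k + 1) ^ (n + 1)) : ℂ) * hsign

theorem integral_log_pow_mul_of_hasSum {ι : Type*} [Countable ι] {c : ι → ℂ} {e : ι → ℕ}
    {f : ℝ → ℂ} (n : ℕ) (hf : ∀ t ∈ Ioo (0 : ℝ) 1, HasSum (fun k => c k * (t : ℂ) ^ e k) (f t))
    (hsum : Summable fun k => ‖c k‖ / ((e k : ℝ) + 1) ^ (n + 1)) :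
    ∫ t in Ioo (0 : ℝ) 1, (Real.log t : ℂ) ^ n * f t =
      (-1) ^ n * n.factorial * ∑' k, c k / ((e k : ℂ) + 1) ^ (n + 1) := by
  have hexchange := hasSum_integral_of_summable_integral_norm
    (μ := volume.restrict (Ioo (0 : ℝ) 1))
    (F := fun k t => c k * ((Real.log t : ℂ) ^ n * (t : ℂ) ^ e k))
    (fun k => (integrableOn_log_pow_mul_pow n (e k)).const_mul _) (by
      simp_rw [integral_norm_const_mul_log_pow_mul_pow]
      exact (hsum.mul_left (n.factorial : ℝ)).congr fun k => by ring)
  calc ∫ t in Ioo (0 : ℝ) 1, (Real.log t : ℂ) ^ n * f t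
      = ∫ t in Ioo (0 : ℝ) 1, ∑' k, c k * ((Real.log t : ℂ) ^ n * (t : ℂ) ^ e k) :=
        setIntegral_congr_fun measurableSet_Ioo fun t ht => by
          simp only [← (hf t ht).tsum_eq, ← tsum_mul_left]
          exact tsum_congr fun k => by ring
    _ = ∑' k, ∫ t in Ioo (0 : ℝ) 1, c k * ((Real.log t : ℂ) ^ n * (t : ℂ) ^ e k) :=
        hexchange.tsum_eq.symm
    _ = _ := by
        rw [← tsum_mul_left]
        refine tsum_congr fun k => ?_
        rw [integral_const_mul, (hasUnitIntegral_log_pow_mul_pow n (e k)).2]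
        ring

theorem norm_natCast_add_one (k : ℕ) : ‖(k : ℂ) + 1‖ = k + 1 := by
  rw [← Nat.cast_add_one, Complex.norm_natCast, Nat.cast_add_one]

theorem hasSum_log_one_sub {w : ℂ} (hw : ‖w‖ < 1) :
    HasSum (fun k : ℕ => -(1 / ((k : ℂ) + 1)) * w ^ (k + 1)) (Complex.log (1 - w)) := by
  have h := Complex.hasSum_taylorSeries_neg_log hw
  rw [← hasSum_nat_add_iff' 1] at h
  simp only [Finset.sum_range_one, pow_zero, Nat.cast_zero, div_zero, sub_zero] at h
  simpa [div_eq_inv_mul] using h.neg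

theorem summable_one_div_natCast_add_one_pow {s : ℕ} (hs : 1 < s) :
    Summable fun n : ℕ => 1 / ((n : ℝ) + 1) ^ s := by
  simpa using (summable_nat_add_iff 1).2 (Real.summable_one_div_nat_pow.2 hs)

theorem nielsenPolylog_add_one_one {z : ℂ} (hz : ‖z‖ ≤ 1) (n : ℕ) :
    nielsenPolylog (n + 1) 1 z = classicalPolylog (n + 2) z := by
  have hseries : ∀ t ∈ Ioo (0 : ℝ) 1, HasSum (fun k : ℕ => -(z ^ (k + 1) / ((k : ℂ) + 1)) * t ^ k)
      (Complex.log (1 - z * t) / t) := by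
    intro t ht
    have : (t : ℂ) ≠ 0 := Complex.ofReal_ne_zero.2 ht.1.ne'
    refine ((hasSum_log_one_sub ((norm_mul_ofReal_le hz ht).trans_lt ht.2)).div_const
      (t : ℂ)).congr_fun fun k => ?_
    field_simp
    ring
  have hsummable : Summable fun k : ℕ =>
      ‖-(z ^ (k + 1) / ((k : ℂ) + 1))‖ / ((k : ℝ) + 1) ^ (n + 1) := by
    refine (summable_one_div_natCast_add_one_pow (s := n + 2) (by omega)).of_nonneg_of_le
      (fun k => by positivity) fun k => ?_
    rw [norm_neg, norm_div, norm_pow, norm_natCast_add_one, div_div, ← pow_succ']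
    gcongr
    exact pow_le_one₀ (norm_nonneg z) hz
  have h := (hasUnitIntegral_nielsenPolylog hz n 0).2
  simp only [zero_add, pow_one, mul_div_assoc] at h
  rw [integral_log_pow_mul_of_hasSum n hseries hsummable] at h
  have hn : ((-1) ^ n * n.factorial : ℂ) ≠ 0 :=
    mul_ne_zero (pow_ne_zero _ (by norm_num)) (Nat.cast_ne_zero.2 n.factorial_ne_zero)
  have hpolylog : ∑' k : ℕ, -(z ^ (k + 1) / ((k : ℂ) + 1)) / ((k : ℂ) + 1) ^ (n + 1) =
      -classicalPolylog (n + 2) z := by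
    rw [classicalPolylog, ← tsum_neg]
    refine tsum_congr fun k => ?_
    rw [neg_div, div_div, ← pow_succ', Nat.cast_add_one]
  refine mul_left_cancel₀ hn ?_
  rw [hpolylog] at h
  rw [add_zero, Nat.factorial_one, Nat.cast_one, pow_succ] at h
  linear_combination h

theorem classicalPolylog_one_eq_riemannZeta (n : ℕ) :
    classicalPolylog (n + 2) 1 = riemannZeta (n + 2 : ℕ) := by
  rw [zeta_nat_eq_tsum_of_gt_one (by omega), classicalPolylog]
  have h : Summable fun k : ℕ => 1 / (k : ℂ) ^ (n + 2) := .of_norm (by simp)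
  rw [h.tsum_eq_zero_add]
  simp

theorem summable_classicalPolylog {z : ℂ} (hz : ‖z‖ ≤ 1) {m : ℕ} (hm : 1 < m) :
    Summable fun j : ℕ => z ^ (j + 1) / ((j + 1 : ℕ) : ℂ) ^ m := by
  refine .of_norm ((summable_one_div_natCast_add_one_pow hm).of_nonneg_of_le
    (fun _ => norm_nonneg _) fun j => ?_)
  rw [norm_div, norm_pow, norm_pow, Complex.norm_natCast, Nat.cast_add_one]
  gcongr
  exact pow_le_one₀ (norm_nonneg z) hz

theorem classicalPolylog_add_classicalPolylog_neg {z : ℂ} (hz : ‖z‖ ≤ 1) {m : ℕ} (hm : 1 < m) :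
    classicalPolylog m z + classicalPolylog m (-z) =
      2 / 2 ^ m * classicalPolylog m (z ^ 2) := by
  have hz' : ‖-z‖ ≤ 1 := (norm_neg z).trans_le hz
  have hz2 : ‖z ^ 2‖ ≤ 1 := by rw [norm_pow]; exact pow_le_one₀ (norm_nonneg z) hz
  have hsum := (summable_classicalPolylog hz hm).hasSum.add
    (summable_classicalPolylog hz' hm).hasSum
  refine hsum.unique ?_
  rw [← zero_add (2 / 2 ^ m * _)]
  refine HasSum.even_add_odd (hasSum_zero.congr_fun fun k => ?_)
    (((summable_classicalPolylog hz2 hm).hasSum.mul_left (2 / 2 ^ m)).congr_fun fun k => ?_)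
  · rw [(show Odd (2 * k + 1) from ⟨k, rfl⟩).neg_pow]
    ring
  · have : (k : ℂ) + 1 ≠ 0 := k.cast_add_one_ne_zero
    rw [show 2 * k + 1 + 1 = 2 * (k + 1) by ring, (even_two_mul (k + 1)).neg_pow, ← pow_mul]
    push_cast
    rw [mul_pow]
    field_simp
    ring

end PowerSeries

section Tornheim

/-- The general term of Tornheim's double series `∑ 1 / (nᵃ m (n + m)ᶜ)` over `n, m ≥ 1`. -/
noncomputable def tornheimTerm (a c : ℕ) (x : ℕ × ℕ) : ℝ :=
  1 / (((x.1 : ℝ) + 1) ^ a * (x.2 + 1) * (x.1 + x.2 + 2) ^ c)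

/-- The sum `∑ 1 / nˢ` over `n ≥ 1` as a real number; `riemannZeta` is complex-valued. -/
noncomputable def realZeta (s : ℕ) : ℝ := ∑' n : ℕ, 1 / ((n : ℝ) + 1) ^ s

/-- The general term of the double zeta value `∑ 1 / (nᵃ Nᵇ)` over `1 ≤ n < N`, parametrised by
`(n - 1, N - n - 1)`. -/
noncomputable def doubleZetaTerm (a b : ℕ) (x : ℕ × ℕ) : ℝ :=
  1 / (((x.1 : ℝ) + 1) ^ a * (x.1 + x.2 + 2) ^ b)

/-- The double zeta value `∑ 1 / (nᵃ Nᵇ)` over `1 ≤ n < N`. -/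
noncomputable def doubleZeta (a b : ℕ) : ℝ := ∑' x, doubleZetaTerm a b x

variable {a b c : ℕ}

theorem sqrt_mul_sqrt_le_add {x y : ℝ} (hx : 0 ≤ x) (hy : 0 ≤ y) : √x * √y ≤ x + y := by
  calc √x * √y ≤ √(x + y) * √(x + y) := by gcongr <;> linarith
    _ = x + y := Real.mul_self_sqrt (add_nonneg hx hy)

theorem summable_tornheimTerm (ha : a ≠ 0) (hc : c ≠ 0) : Summable (tornheimTerm a c) := by
  have hone : Summable fun k : ℕ => 1 / (((k : ℝ) + 1) * √(k + 1)) := by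
    have := (summable_nat_add_iff 1).2
      (Real.summable_one_div_nat_rpow.2 (show (1 : ℝ) < 3 / 2 by norm_num))
    refine this.congr fun k => ?_
    rw [Nat.cast_add_one, show (3 / 2 : ℝ) = 1 + 1 / 2 by norm_num,
      Real.rpow_add (by positivity), Real.rpow_one, Real.sqrt_eq_rpow]
  refine (hone.mul_of_nonneg hone (fun k => by positivity) fun k => by positivity).of_nonneg_of_le
    (fun x => by unfold tornheimTerm; positivity) fun ⟨n, m⟩ => ?_
  rw [tornheimTerm, one_div_mul_one_div]
  have _ : (0 : ℝ) ≤ n := n.cast_nonneg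
  have _ : (0 : ℝ) ≤ m := m.cast_nonneg
  have hsqrt : √((n : ℝ) + 1) * √((m : ℝ) + 1) ≤ (n + m + 2) ^ c :=
    calc √((n : ℝ) + 1) * √((m : ℝ) + 1) ≤ n + 1 + (m + 1) :=
          sqrt_mul_sqrt_le_add (by linarith) (by linarith)
      _ = n + m + 2 := by ring
      _ ≤ (n + m + 2) ^ c := le_self_pow₀ (by linarith) hc
  have hpow : (n : ℝ) + 1 ≤ (n + 1) ^ a := le_self_pow₀ (by linarith) ha
  refine one_div_le_one_div_of_le (by positivity) ?_
  calc ((n : ℝ) + 1) * √(n + 1) * ((m + 1) * √(m + 1))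
      = (n + 1) * (m + 1) * (√(n + 1) * √(m + 1)) := by ring
    _ ≤ (n + 1) ^ a * (m + 1) * (n + m + 2) ^ c := by gcongr

theorem summable_doubleZetaTerm (ha : a ≠ 0) (hb : 1 < b) : Summable (doubleZetaTerm a b) := by
  obtain ⟨c, rfl⟩ := Nat.exists_eq_add_of_le' hb
  refine (summable_tornheimTerm ha c.add_one_ne_zero).of_nonneg_of_le
    (fun x => by unfold doubleZetaTerm; positivity) fun ⟨n, m⟩ => ?_
  refine one_div_le_one_div_of_le (by positivity) ?_
  rw [mul_assoc, show c + Nat.succ 1 = c + 1 + 1 from rfl, pow_succ' _ (c + 1)]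
  gcongr
  · norm_num
  · linarith [n.cast_nonneg (α := ℝ)]

theorem hasSum_realZeta {s : ℕ} (hs : 1 < s) :
    HasSum (fun n : ℕ => 1 / ((n : ℝ) + 1) ^ s) (realZeta s) :=
  (summable_one_div_natCast_add_one_pow hs).hasSum

theorem riemannZeta_eq_realZeta (n : ℕ) : riemannZeta (n + 2 : ℕ) = realZeta (n + 2) := by
  rw [← classicalPolylog_one_eq_riemannZeta, classicalPolylog, realZeta, Complex.ofReal_tsum]
  refine tsum_congr fun k => ?_
  push_cast
  rw [one_pow]

theorem hasSum_log_one_sub_sq {w : ℂ} (hw : ‖w‖ < 1) :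
    HasSum (fun x : ℕ × ℕ => 1 / (((x.1 : ℂ) + 1) * (x.2 + 1)) * w ^ (x.1 + x.2 + 2))
      (Complex.log (1 - w) ^ 2) := by
  have hlog := hasSum_log_one_sub hw
  generalize hf : (fun k : ℕ => -(1 / ((k : ℂ) + 1)) * w ^ (k + 1)) = f at hlog
  have hnorm := hlog.summable.norm
  rw [sq]
  refine (hlog.mul hlog (summable_mul_of_summable_norm hnorm hnorm)).congr_fun fun x => ?_
  simp only [← hf]
  generalize (x.1 : ℂ) + 1 = a, (x.2 : ℂ) + 1 = b
  ring

theorem nielsenPolylog_add_one_two_one_eq_tsum (i : ℕ) :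
    nielsenPolylog (i + 1) 2 1 = ((∑' x, tornheimTerm 1 (i + 1) x : ℝ) : ℂ) / 2 := by
  have hseries : ∀ t ∈ Ioo (0 : ℝ) 1,
      HasSum (fun x : ℕ × ℕ => 1 / (((x.1 : ℂ) + 1) * (x.2 + 1)) * (t : ℂ) ^ (x.1 + x.2 + 1))
        (Complex.log (1 - 1 * t) ^ 2 / t) := by
    intro t ht
    have ht0 : (t : ℂ) ≠ 0 := Complex.ofReal_ne_zero.2 ht.1.ne'
    refine ((hasSum_log_one_sub_sq ((norm_mul_ofReal_le norm_one.le ht).trans_lt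
      ht.2)).div_const (t : ℂ)).congr_fun fun x => ?_
    rw [one_mul, mul_div_assoc, pow_succ _ (x.1 + x.2 + 1), mul_div_cancel_right₀ _ ht0]
  have hsummable : Summable fun x : ℕ × ℕ => ‖1 / (((x.1 : ℂ) + 1) * (x.2 + 1))‖ /
      (((x.1 + x.2 + 1 : ℕ) : ℝ) + 1) ^ (i + 1) := by
    refine (summable_tornheimTerm one_ne_zero i.add_one_ne_zero).congr fun x => ?_
    rw [norm_div, norm_mul, norm_natCast_add_one, norm_natCast_add_one, norm_one, tornheimTerm,
      div_div]
    push_cast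
    ring
  have h := (hasUnitIntegral_nielsenPolylog norm_one.le i 1).2
  simp only [mul_div_assoc] at h
  rw [integral_log_pow_mul_of_hasSum i hseries hsummable] at h
  have hn : ((-1) ^ i * i.factorial : ℂ) ≠ 0 :=
    mul_ne_zero (pow_ne_zero _ (by norm_num)) (Nat.cast_ne_zero.2 i.factorial_ne_zero)
  rw [eq_div_iff two_ne_zero]
  refine mul_left_cancel₀ hn ?_
  have htornheim : ((∑' x, tornheimTerm 1 (i + 1) x : ℝ) : ℂ) = ∑' x : ℕ × ℕ,
      1 / (((x.1 : ℂ) + 1) * (x.2 + 1)) / (((x.1 + x.2 + 1 : ℕ) : ℂ) + 1) ^ (i + 1) := by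
    rw [Complex.ofReal_tsum]
    refine tsum_congr fun x => ?_
    rw [tornheimTerm, div_div]
    push_cast
    ring
  rw [htornheim, h, Nat.factorial_two]
  push_cast
  ring

theorem tsum_tornheimTerm_one (hc : c ≠ 0) :
    ∑' x, tornheimTerm 1 c x = 2 * doubleZeta 1 (c + 1) := by
  have hsummable := summable_doubleZetaTerm one_ne_zero (show 1 < c + 1 by omega)
  have hswap : Summable fun x => doubleZetaTerm 1 (c + 1) (Prod.swap x) :=
    (Equiv.prodComm ℕ ℕ).summable_iff.2 hsummable
  have htsum : ∑' x, doubleZetaTerm 1 (c + 1) (Prod.swap x) = doubleZeta 1 (c + 1) :=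
    (Equiv.prodComm ℕ ℕ).tsum_eq _
  -- `1 / (n m) = (1 / n + 1 / m) / (n + m)`
  calc ∑' x, tornheimTerm 1 c x
      = ∑' x, (doubleZetaTerm 1 (c + 1) x + doubleZetaTerm 1 (c + 1) (Prod.swap x)) := by
        refine tsum_congr fun x => ?_
        simp only [tornheimTerm, doubleZetaTerm, Prod.fst_swap, Prod.snd_swap]
        rw [add_comm (x.2 : ℝ) x.1]
        field_simp
        ring
    _ = 2 * doubleZeta 1 (c + 1) := by
        rw [hsummable.tsum_add hswap, htsum, doubleZeta]
        ring

theorem tsum_tornheimTerm_succ (hc : c ≠ 0) :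
    ∑' x, tornheimTerm a (c + 1) x =
      ∑' x, tornheimTerm (a + 1) c x - doubleZeta (a + 1) (c + 1) := by
  -- `1 / (m (n + m)) = (1 / m - 1 / (n + m)) / n`
  rw [doubleZeta, ← (summable_tornheimTerm a.add_one_ne_zero hc).tsum_sub
    (summable_doubleZetaTerm a.add_one_ne_zero (by omega))]
  refine tsum_congr fun x => ?_
  simp only [tornheimTerm, doubleZetaTerm]
  field_simp
  ring

theorem tsum_tornheimTerm_add_one (a q : ℕ) :
    ∑' x, tornheimTerm a (q + 1) x = ∑' x, tornheimTerm (a + q) 1 x -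
      ∑ k ∈ Finset.range q, doubleZeta (a + k + 1) (q - k + 1) := by
  induction q generalizing a with
  | zero => simp
  | succ q ih =>
    rw [tsum_tornheimTerm_succ q.add_one_ne_zero, ih, Finset.sum_range_succ',
      add_right_comm a 1 q, add_assoc a q 1, ← sub_sub]
    simp only [Nat.add_sub_add_right, Nat.sub_zero, add_zero]
    ring_nf

theorem hasSum_of_hasSum_diagonal_of_hasSum_lt_of_hasSum_gt {f : ℕ × ℕ → ℝ} {s t u : ℝ}
    (hs : HasSum (fun n => f (n, n)) s)
    (ht : HasSum (fun x : ℕ × ℕ => f (x.1, x.1 + x.2 + 1)) t)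
    (hu : HasSum (fun x : ℕ × ℕ => f (x.1 + x.2 + 1, x.1)) u) : HasSum f (s + t + u) := by
  have diag_injective : Function.Injective fun n : ℕ => (n, n) := fun n m h => (Prod.mk.inj h).1
  have lt_injective : Function.Injective fun x : ℕ × ℕ => (x.1, x.1 + x.2 + 1) := fun x y h => by
    obtain ⟨hfst, hsnd⟩ := Prod.mk.inj h
    ext <;> omega
  have gt_injective : Function.Injective fun x : ℕ × ℕ => (x.1 + x.2 + 1, x.1) := fun x y h => by
    obtain ⟨hfst, hsnd⟩ := Prod.mk.inj h
    ext <;> omega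
  have hle := HasSum.add_disjoint (by
    rw [Set.disjoint_left]
    rintro _ ⟨n, rfl⟩ ⟨x, hx⟩
    obtain ⟨hfst, hsnd⟩ := Prod.mk.inj hx
    omega) (diag_injective.hasSum_range_iff (f := f).2 hs)
    (lt_injective.hasSum_range_iff (f := f).2 ht)
  refine HasSum.add_isCompl ⟨Set.disjoint_left.2 ?_, codisjoint_iff_le_sup.2 ?_⟩ hle
    (gt_injective.hasSum_range_iff (f := f).2 hu)
  · rintro _ (⟨n, rfl⟩ | ⟨y, rfl⟩) ⟨x, hx⟩ <;> obtain ⟨hfst, hsnd⟩ := Prod.mk.inj hx <;> omega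
  · rintro ⟨n, m⟩ -
    rcases lt_trichotomy n m with hlt | rfl | hgt
    · exact Or.inl (Or.inr ⟨(n, m - n - 1), Prod.ext rfl (by simp only; omega)⟩)
    · exact Or.inl (Or.inl ⟨n, rfl⟩)
    · exact Or.inr ⟨(m, n - m - 1), Prod.ext (by simp only; omega) rfl⟩

theorem realZeta_mul_realZeta (ha : 1 < a) (hb : 1 < b) :
    realZeta a * realZeta b = realZeta (a + b) + doubleZeta a b + doubleZeta b a := by
  have hasum := hasSum_realZeta ha
  have hbsum := hasSum_realZeta hb
  have hmul := hasum.mul hbsum (hasum.summable.mul_of_nonneg hbsum.summable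
    (fun n => by simp only [Pi.zero_apply]; positivity)
    (fun n => by simp only [Pi.zero_apply]; positivity))
  refine hmul.unique (hasSum_of_hasSum_diagonal_of_hasSum_lt_of_hasSum_gt ?_ ?_ ?_)
  · refine (hasSum_realZeta (s := a + b) (by omega)).congr_fun fun n => ?_
    rw [one_div_mul_one_div, pow_add]
  · refine (summable_doubleZetaTerm (by omega) hb).hasSum.congr_fun fun x => ?_
    rw [one_div_mul_one_div, doubleZetaTerm]
    push_cast
    ring_nf
  · refine (summable_doubleZetaTerm (by omega) ha).hasSum.congr_fun fun x => ?_
    rw [one_div_mul_one_div, doubleZetaTerm]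
    push_cast
    ring_nf

theorem hasSum_sub_add_of_antitone {g : ℕ → ℝ} (hg : Tendsto g atTop (𝓝 0)) (hm : Antitone g)
    (q : ℕ) : HasSum (fun m => g m - g (m + q)) (∑ k ∈ Finset.range q, g k) := by
  rw [hasSum_iff_tendsto_nat_of_nonneg fun m => sub_nonneg.2 (hm (Nat.le_add_right m q))]
  have hpartial : ∀ M, ∑ m ∈ Finset.range M, (g m - g (m + q)) =
      ∑ k ∈ Finset.range q, g k - ∑ k ∈ Finset.range q, g (M + k) := fun M => by
    have hMq := Finset.sum_range_add g M q
    have hqM := Finset.sum_range_add g q M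
    rw [add_comm q M] at hqM
    rw [Finset.sum_sub_distrib]
    simp_rw [add_comm _ q]
    linarith
  simp_rw [hpartial]
  have htail : Tendsto (fun M => ∑ k ∈ Finset.range q, g (M + k)) atTop (𝓝 0) := by
    simpa using tendsto_finsetSum (Finset.range q) fun k _ => (tendsto_add_atTop_iff_nat k).2 hg
  simpa using tendsto_const_nhds.sub htail

theorem tsum_one_div_mul_add (n : ℕ) :
    ∑' m : ℕ, 1 / (((m : ℝ) + 1) * (n + m + 2)) =
      (∑ k ∈ Finset.range (n + 1), 1 / ((k : ℝ) + 1)) / (n + 1) := by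
  have h := hasSum_sub_add_of_antitone tendsto_one_div_add_atTop_nhds_zero_nat
    (fun i j hij => one_div_le_one_div_of_le (by positivity) (by gcongr)) (n + 1)
  rw [← (h.div_const ((n : ℝ) + 1)).tsum_eq]
  refine tsum_congr fun m => ?_
  push_cast
  field_simp
  ring

theorem hasSum_sum_range_one_div (hb : 1 < b) :
    HasSum (fun n : ℕ => (∑ k ∈ Finset.range (n + 1), 1 / ((k : ℝ) + 1)) / (n + 1) ^ b)
      (realZeta (b + 1) + doubleZeta 1 b) := by
  have hle : HasSum (fun x : ℕ × ℕ =>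
      if x.2 ≤ x.1 then 1 / (((x.2 : ℝ) + 1) * (x.1 + 1) ^ b) else 0)
      (realZeta (b + 1) + 0 + doubleZeta 1 b) := by
    refine hasSum_of_hasSum_diagonal_of_hasSum_lt_of_hasSum_gt ?_ ?_ ?_
    · refine (hasSum_realZeta (s := b + 1) (by omega)).congr_fun fun n => ?_
      rw [if_pos le_rfl, pow_succ']
    · refine hasSum_zero.congr_fun fun x => if_neg ?_
      simp only
      omega
    · refine (summable_doubleZetaTerm one_ne_zero hb).hasSum.congr_fun fun x => ?_
      rw [if_pos (by simp only; omega), doubleZetaTerm]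
      push_cast
      ring_nf
  rw [add_zero] at hle
  refine hle.prod_fiberwise fun n => ?_
  have hsum : (∑ k ∈ Finset.range (n + 1), 1 / ((k : ℝ) + 1)) / (n + 1) ^ b =
      ∑ k ∈ Finset.range (n + 1), if k ≤ n then 1 / (((k : ℝ) + 1) * (n + 1) ^ b) else 0 := by
    rw [Finset.sum_div]
    refine Finset.sum_congr rfl fun k hk => ?_
    rw [if_pos (Finset.mem_range_succ_iff.1 hk), div_div]
  rw [hsum]
  exact hasSum_sum_of_ne_finset_zero fun k hk => if_neg (by simpa using hk)

theorem tsum_tornheimTerm_add_one_one (a : ℕ) :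
    ∑' x, tornheimTerm (a + 1) 1 x = doubleZeta 1 (a + 2) + realZeta (a + 3) := by
  rw [(summable_tornheimTerm a.add_one_ne_zero one_ne_zero).tsum_prod, add_comm (doubleZeta _ _),
    ← (hasSum_sum_range_one_div (b := a + 2) (by omega)).tsum_eq]
  refine tsum_congr fun n => ?_
  rw [pow_succ, ← div_div, div_right_comm, ← tsum_one_div_mul_add, div_eq_inv_mul,
    ← tsum_mul_left]
  refine tsum_congr fun m => ?_
  rw [tornheimTerm, pow_one, mul_assoc, ← one_div, one_div_mul_one_div]

theorem two_mul_sum_doubleZeta (q : ℕ) :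
    2 * ∑ k ∈ Finset.range q, doubleZeta (k + 2) (q + 1 - k) =
      ∑ k ∈ Finset.range q, realZeta (k + 2) * realZeta (q + 1 - k) - q * realZeta (q + 3) := by
  have hreflect : ∑ k ∈ Finset.range q, doubleZeta (q + 1 - k) (k + 2) =
      ∑ k ∈ Finset.range q, doubleZeta (k + 2) (q + 1 - k) := by
    rw [← Finset.sum_range_reflect]
    refine Finset.sum_congr rfl fun k hk => ?_
    have := Finset.mem_range.1 hk
    congr 1 <;> omega
  have hstuffle : ∀ k ∈ Finset.range q, realZeta (k + 2) * realZeta (q + 1 - k) =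
      realZeta (q + 3) + doubleZeta (k + 2) (q + 1 - k) + doubleZeta (q + 1 - k) (k + 2) := by
    intro k hk
    have := Finset.mem_range.1 hk
    rw [realZeta_mul_realZeta (by omega) (by omega), show k + 2 + (q + 1 - k) = q + 3 by omega]
  rw [Finset.sum_congr rfl hstuffle, Finset.sum_add_distrib, Finset.sum_add_distrib, hreflect,
    Finset.sum_const, Finset.card_range, nsmul_eq_mul]
  ring

theorem tsum_tornheimTerm_one_add_one (q : ℕ) :
    ∑' x, tornheimTerm 1 (q + 1) x = (q + 2) * realZeta (q + 3) -
      ∑ k ∈ Finset.range q, realZeta (k + 2) * realZeta (q + 1 - k) := by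
  have hdouble := tsum_tornheimTerm_one q.add_one_ne_zero
  have hshift := tsum_tornheimTerm_add_one 1 q
  have hone := tsum_tornheimTerm_add_one_one q
  have hsum : ∑ k ∈ Finset.range q, doubleZeta (1 + k + 1) (q - k + 1) =
      ∑ k ∈ Finset.range q, doubleZeta (k + 2) (q + 1 - k) := by
    refine Finset.sum_congr rfl fun k hk => ?_
    have := Finset.mem_range.1 hk
    congr 1 <;> omega
  rw [add_comm 1 q, hone, hsum] at hshift
  have hstuffle := two_mul_sum_doubleZeta q
  linarith

theorem nielsenPolylog_add_one_two_one (i : ℕ) :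
    nielsenPolylog (i + 1) 2 1 = ((i + 2) * riemannZeta (i + 3 : ℕ) -
      ∑ k ∈ Finset.range i, riemannZeta (k + 2 : ℕ) * riemannZeta (i + 1 - k : ℕ)) / 2 := by
  rw [nielsenPolylog_add_one_two_one_eq_tsum, tsum_tornheimTerm_one_add_one,
    riemannZeta_eq_realZeta (i + 1)]
  push_cast
  congr 2
  refine Finset.sum_congr rfl fun k hk => ?_
  have := Finset.mem_range.1 hk
  obtain ⟨m, hm⟩ : ∃ m, i + 1 - k = m + 2 := ⟨i - 1 - k, by omega⟩
  rw [hm, ← riemannZeta_eq_realZeta, ← riemannZeta_eq_realZeta]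
  push_cast
  rfl

end Tornheim

section SixthRoot

/-- The primitive sixth root of unity `exp (2πi / 6)`. -/
noncomputable def sixthRoot : ℂ := Complex.exp (2 * (Real.pi : ℂ) * Complex.I / 6)

/-- The principal logarithm `πi / 3` of `sixthRoot`. -/
noncomputable def logSixthRoot : ℂ := Real.pi * Complex.I / 3

variable {t : ℝ}

theorem exp_logSixthRoot : Complex.exp logSixthRoot = sixthRoot := by
  rw [sixthRoot, logSixthRoot]
  congr 1
  ring

theorem logSixthRoot_eq_ofReal_mul_I : logSixthRoot = (Real.pi / 3 : ℝ) * Complex.I := by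
  rw [logSixthRoot]
  push_cast
  ring

theorem logSixthRoot_im : logSixthRoot.im = Real.pi / 3 := by
  rw [logSixthRoot_eq_ofReal_mul_I, Complex.im_ofReal_mul, Complex.I_im, mul_one]

theorem sixthRoot_re : sixthRoot.re = 1 / 2 := by
  rw [← exp_logSixthRoot, logSixthRoot_eq_ofReal_mul_I, Complex.exp_ofReal_mul_I_re,
    Real.cos_pi_div_three]

theorem sixthRoot_im : sixthRoot.im = √3 / 2 := by
  rw [← exp_logSixthRoot, logSixthRoot_eq_ofReal_mul_I, Complex.exp_ofReal_mul_I_im,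
    Real.sin_pi_div_three]

theorem norm_sixthRoot : ‖sixthRoot‖ = 1 := by
  rw [← exp_logSixthRoot, logSixthRoot_eq_ofReal_mul_I, Complex.norm_exp_ofReal_mul_I]

theorem sixthRoot_ne_zero : sixthRoot ≠ 0 := Complex.exp_ne_zero _

theorem sixthRoot_sq : sixthRoot ^ 2 = sixthRoot - 1 := by
  have hsqrt := Real.sq_sqrt (show (0 : ℝ) ≤ 3 by norm_num)
  apply Complex.ext
  · simp only [sq, Complex.mul_re, Complex.sub_re, sixthRoot_re, sixthRoot_im, Complex.one_re]
    linarith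
  · simp only [sq, Complex.mul_im, Complex.sub_im, sixthRoot_re, sixthRoot_im, Complex.one_im]
    linarith

theorem inv_one_sub_sixthRoot : (1 - sixthRoot)⁻¹ = sixthRoot := by
  refine inv_eq_of_mul_eq_one_right ?_
  linear_combination -sixthRoot_sq

theorem log_sixthRoot : Complex.log sixthRoot = logSixthRoot := by
  rw [← exp_logSixthRoot, Complex.log_exp] <;> rw [logSixthRoot_im] <;> linarith [Real.pi_pos]

theorem log_sixthRoot_mul (ht : 0 < t) :
    Complex.log (sixthRoot * t) = Real.log t + logSixthRoot := by
  rw [mul_comm, Complex.log_ofReal_mul ht sixthRoot_ne_zero, log_sixthRoot]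

theorem one_sub_sixthRoot_mul_re : (1 - sixthRoot * t).re = 1 - t / 2 := by
  rw [Complex.sub_re, Complex.one_re, Complex.re_mul_ofReal, sixthRoot_re]
  ring

theorem one_sub_sixthRoot_mul_im : (1 - sixthRoot * t).im = -(√3 / 2 * t) := by
  rw [Complex.sub_im, Complex.one_im, Complex.im_mul_ofReal, sixthRoot_im, zero_sub]

theorem one_sub_sixthRoot_mul_mem_slitPlane (ht : t ≤ 1) :
    1 - sixthRoot * t ∈ Complex.slitPlane := by
  refine Complex.mem_slitPlane_iff.2 (.inl ?_)
  rw [one_sub_sixthRoot_mul_re]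
  linarith

theorem log_inv_one_sub_sixthRoot_mul (ht : t ≤ 1) :
    Complex.log (1 - sixthRoot * t)⁻¹ = -Complex.log (1 - sixthRoot * t) :=
  Complex.log_inv _ (Complex.slitPlane_arg_ne_pi (one_sub_sixthRoot_mul_mem_slitPlane ht))

theorem log_one_sub_sixthRoot : Complex.log (1 - sixthRoot) = -logSixthRoot := by
  have h := log_inv_one_sub_sixthRoot_mul le_rfl
  rw [Complex.ofReal_one, mul_one, inv_one_sub_sixthRoot, log_sixthRoot] at h
  rw [h, neg_neg]

theorem exp_neg_two_mul_logSixthRoot : Complex.exp (-(2 * logSixthRoot)) = -sixthRoot := by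
  rw [Complex.exp_neg, two_mul, Complex.exp_add, exp_logSixthRoot]
  refine inv_eq_of_mul_eq_one_right ?_
  linear_combination -(sixthRoot + 1) * sixthRoot_sq

theorem log_one_sub_inv_one_sub_sixthRoot_mul (ht0 : 0 < t) (ht : t ≤ 1) :
    Complex.log (1 - (1 - sixthRoot * t)⁻¹) =
      Real.log t - 2 * logSixthRoot - Complex.log (1 - sixthRoot * t) := by
  have hne := Complex.slitPlane_ne_zero (one_sub_sixthRoot_mul_mem_slitPlane ht)
  have hexp : 1 - (1 - sixthRoot * t)⁻¹ = Complex.exp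
      (Real.log t - 2 * logSixthRoot - Complex.log (1 - sixthRoot * t)) := by
    rw [Complex.exp_sub, Complex.exp_log hne, sub_eq_add_neg (Real.log t : ℂ), Complex.exp_add,
      exp_neg_two_mul_logSixthRoot, ← Complex.ofReal_exp, Real.exp_log ht0]
    field_simp
    ring
  have harg : (1 - sixthRoot * t).arg < 0 := by
    rw [Complex.arg_neg_iff, one_sub_sixthRoot_mul_im]
    have : 0 < √3 / 2 * t := by positivity
    linarith
  have harg' : |(1 - sixthRoot * t).arg| < Real.pi / 2 := by
    rw [Complex.abs_arg_lt_pi_div_two_iff, one_sub_sixthRoot_mul_re]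
    left
    linarith
  have him : (Real.log t - 2 * logSixthRoot - Complex.log (1 - sixthRoot * t)).im =
      -(2 * (Real.pi / 3)) - (1 - sixthRoot * t).arg := by
    rw [Complex.sub_im, Complex.sub_im, Complex.log_im, Complex.ofReal_im, ← logSixthRoot_im,
      two_mul, Complex.add_im]
    ring
  rw [hexp, Complex.log_exp] <;> rw [him] <;> linarith [Real.pi_pos, (abs_lt.1 harg').1]

end SixthRoot

section LensDisc

/-- The disc with diameter `[0, 1 + i]`: it contains the open unit interval and `sixthRoot`, has
`0` and `1` on its boundary, and avoids the cuts of `log x` and of `log (1 - x)`. -/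
noncomputable def lensDisc : Set ℂ := Metric.ball ((1 + Complex.I) / 2) √(1 / 2)

variable {x w : ℂ} {t : ℝ}

theorem mem_lensDisc : x ∈ lensDisc ↔ x.re ^ 2 + x.im ^ 2 < x.re + x.im := by
  have hre : ((1 + Complex.I) / 2).re = 1 / 2 := by simp
  have him : ((1 + Complex.I) / 2).im = 1 / 2 := by simp
  rw [lensDisc, mem_ball_iff_norm, Real.lt_sqrt (norm_nonneg _), Complex.sq_norm,
    Complex.normSq_apply, Complex.sub_re, Complex.sub_im, hre, him]
  constructor <;> intro h <;> nlinarith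

theorem mem_slitPlane_of_mem_lensDisc (hx : x ∈ lensDisc) : x ∈ Complex.slitPlane := by
  rw [mem_lensDisc] at hx
  refine Complex.mem_slitPlane_iff.2 (or_iff_not_imp_right.2 fun him => ?_)
  rw [not_not.1 him] at hx
  nlinarith

theorem one_sub_mem_slitPlane_of_mem_lensDisc (hx : x ∈ lensDisc) :
    1 - x ∈ Complex.slitPlane := by
  rw [mem_lensDisc] at hx
  refine Complex.mem_slitPlane_iff.2 (or_iff_not_imp_right.2 fun him => ?_)
  rw [Complex.sub_im, Complex.one_im, zero_sub, neg_ne_zero, not_not] at him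
  rw [him] at hx
  rw [Complex.sub_re, Complex.one_re]
  nlinarith

theorem ofReal_mem_lensDisc (ht : t ∈ Ioo (0 : ℝ) 1) : (t : ℂ) ∈ lensDisc := by
  rw [mem_lensDisc, Complex.ofReal_re, Complex.ofReal_im]
  nlinarith [ht.1, ht.2]

theorem one_lt_sqrt_three : 1 < √(3 : ℝ) := by
  rw [Real.lt_sqrt zero_le_one]
  norm_num

theorem sixthRoot_mul_mem_lensDisc (ht0 : 0 < t) (ht : t ≤ 1) : sixthRoot * t ∈ lensDisc := by
  have hsqrt := Real.sq_sqrt (show (0 : ℝ) ≤ 3 by norm_num)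
  have hnorm : (1 / 2 * t) ^ 2 + (√3 / 2 * t) ^ 2 = t ^ 2 := by
    linear_combination t ^ 2 / 4 * hsqrt
  rw [mem_lensDisc, Complex.re_mul_ofReal, Complex.im_mul_ofReal, sixthRoot_re, sixthRoot_im,
    hnorm]
  nlinarith [one_lt_sqrt_three]

theorem one_sub_ne_zero_of_re_lt_im (hw : w.re < w.im) : 1 - w ≠ 0 := fun h => by
  rw [← sub_eq_zero.1 h, Complex.one_re, Complex.one_im] at hw
  linarith

theorem inv_one_sub_mem_lensDisc (hw : w.re < w.im) : (1 - w)⁻¹ ∈ lensDisc := by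
  have hpos : 0 < Complex.normSq (1 - w) := Complex.normSq_pos.2 (one_sub_ne_zero_of_re_lt_im hw)
  have hnorm : (1 - w)⁻¹.re ^ 2 + (1 - w)⁻¹.im ^ 2 = 1 / Complex.normSq (1 - w) := by
    rw [sq, sq, ← Complex.normSq_apply, Complex.normSq_inv, one_div]
  rw [mem_lensDisc, hnorm, Complex.inv_re, Complex.inv_im, ← add_div,
    div_lt_div_iff_of_pos_right hpos, Complex.sub_re, Complex.sub_im, Complex.one_re,
    Complex.one_im]
  linarith

theorem sixthRoot_mul_re_lt_im (ht : 0 < t) : (sixthRoot * t).re < (sixthRoot * t).im := by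
  rw [Complex.re_mul_ofReal, Complex.im_mul_ofReal, sixthRoot_re, sixthRoot_im]
  nlinarith [one_lt_sqrt_three]

theorem convex_setOf_re_lt_im : Convex ℝ {w : ℂ | w.re < w.im} := by
  have h : {w : ℂ | w.re < w.im} = {w | (Complex.reLm - Complex.imLm) w < 0} := by
    ext w
    simp [sub_neg]
  rw [h]
  exact convex_halfSpace_lt (LinearMap.isLinear _) 0

end LensDisc

section Contour

theorem exists_pos_forall_mem_segment_le_norm {u v : ℂ} (huv : 0 ∉ segment ℝ u v) :
    ∃ m > 0, ∀ w ∈ segment ℝ u v, m ≤ ‖w‖ := by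
  have hcompact : IsCompact (segment ℝ u v) := by
    rw [segment_eq_image_lineMap]
    exact isCompact_Icc.image AffineMap.lineMap_continuous
  obtain ⟨w₀, hw₀, hmin⟩ := hcompact.exists_isMinOn ⟨u, left_mem_segment ℝ u v⟩
    continuous_norm.continuousOn
  exact ⟨‖w₀‖, norm_pos_iff.2 (ne_of_mem_of_not_mem hw₀ huv), fun w hw => hmin hw⟩

theorem exists_mem_segment_of_mem_segment_mul {u v c z : ℂ} (hz : z ∈ segment ℝ (u * c) (v * c)) :
    ∃ w ∈ segment ℝ u v, z = w * c := by
  obtain ⟨a, b, ha, hb, hab, rfl⟩ := hz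
  exact ⟨a • u + b • v, ⟨a, b, ha, hb, hab, rfl⟩, by
    rw [add_mul, smul_mul_assoc, smul_mul_assoc]⟩

theorem norm_le_add_of_mem_segment {u v w : ℂ} (hw : w ∈ segment ℝ u v) : ‖w‖ ≤ ‖u‖ + ‖v‖ :=
  ((convexOn_univ_norm (E := ℂ)).le_max_of_mem_segment (mem_univ u) (mem_univ v) hw).trans
    (max_le_add_of_nonneg (norm_nonneg u) (norm_nonneg v))

theorem tendsto_sub_of_tendsto_mul_deriv {F f : ℂ → ℂ} {D : Set ℂ} {u v : ℂ} (hD : Convex ℝ D)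
    (hF : ∀ z ∈ D, HasDerivWithinAt F (f z) D z)
    (hf : Tendsto (fun z => z * f z) (𝓝[D] 0) (𝓝 0)) (huv : 0 ∉ segment ℝ u v)
    (hu : ∀ᶠ ε : ℝ in 𝓝[>] 0, u * ε ∈ D) (hv : ∀ᶠ ε : ℝ in 𝓝[>] 0, v * ε ∈ D) :
    Tendsto (fun ε : ℝ => F (v * ε) - F (u * ε)) (𝓝[>] 0) (𝓝 0) := by
  obtain ⟨m, hm, hmle⟩ := exists_pos_forall_mem_segment_le_norm huv
  rw [Metric.tendsto_nhds]
  intro η hη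
  set κ : ℝ := η * m / (‖v - u‖ + 1) with hκ
  obtain ⟨δ, hδ, hsmall⟩ := Metric.tendsto_nhdsWithin_nhds.1 hf κ (by positivity)
  have hscale : ∀ᶠ ε : ℝ in 𝓝[>] 0, ε * (‖u‖ + ‖v‖) < δ := nhdsWithin_le_nhds
    ((continuous_mul_const _).tendsto' 0 0 (zero_mul _) |>.eventually_lt_const hδ)
  filter_upwards [hu, hv, hscale, self_mem_nhdsWithin] with ε huε hvε hε hε0
  rw [mem_Ioi] at hε0
  have hsub : segment ℝ (u * ε) (v * ε) ⊆ D := hD.segment_subset huε hvε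
  have hbound : ∀ z ∈ segment ℝ (u * ε) (v * ε), ‖f z‖ ≤ κ / (m * ε) := by
    intro z hz
    obtain ⟨w, hw, rfl⟩ := exists_mem_segment_of_mem_segment_mul hz
    have hnorm : ‖w * (ε : ℂ)‖ = ‖w‖ * ε := by
      rw [norm_mul, Complex.norm_real, Real.norm_of_nonneg hε0.le]
    have hzf := hsmall (hsub hz) (by
      rw [dist_zero_right, hnorm, mul_comm]
      exact (mul_le_mul_of_nonneg_left (norm_le_add_of_mem_segment hw) hε0.le).trans_lt hε)
    rw [dist_zero_right, norm_mul, hnorm] at hzf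
    rw [le_div_iff₀ (by positivity), mul_comm]
    refine le_trans ?_ hzf.le
    gcongr
    exact hmle w hw
  have hdist := (convex_segment (u * (ε : ℂ)) (v * ε)).norm_image_sub_le_of_norm_hasDerivWithin_le
    (fun z hz => (hF z (hsub hz)).mono hsub) hbound (left_mem_segment ℝ _ _)
    (right_mem_segment ℝ _ _)
  rw [dist_zero_right]
  calc ‖F (v * ε) - F (u * ε)‖ ≤ κ / (m * ε) * ‖v * (ε : ℂ) - u * ε‖ := hdist
    _ = η * (‖v - u‖ / (‖v - u‖ + 1)) := by
      rw [← sub_mul, norm_mul, Complex.norm_real, Real.norm_of_nonneg hε0.le, hκ]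
      field_simp
    _ < η := mul_lt_of_lt_one_right hη ((div_lt_one (by positivity)).2 (lt_add_one _))

theorem HasUnitIntegral.tendsto_sub {ι : Type*} {l : Filter ι} {f F : ℝ → ℂ} {v : ℂ}
    {a b : ι → ℝ} (hf : HasUnitIntegral f v) (ha : Tendsto a l (𝓝[Icc 0 1] 0))
    (hb : Tendsto b l (𝓝[Icc 0 1] 1))
    (hF : ∀ᶠ i in l, ∀ t ∈ uIcc (a i) (b i), HasDerivAt F (f t) t) :
    Tendsto (fun i => F (b i) - F (a i)) l (𝓝 v) := by
  have hint := hf.intervalIntegrable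
  have hcont : ContinuousOn (fun x => ∫ t in (0 : ℝ)..x, f t) (Icc 0 1) := by
    have h := intervalIntegral.continuousOn_primitive_interval' hint left_mem_uIcc
    rwa [uIcc_of_le zero_le_one] at h
  have hsub : ∀ x ∈ Icc (0 : ℝ) 1, IntervalIntegrable f volume 0 x := fun x hx =>
    hint.mono_set (uIcc_subset_uIcc_left (by rwa [uIcc_of_le zero_le_one]))
  have hlim := ((hcont 1 (right_mem_Icc.2 zero_le_one)).tendsto.comp hb).sub
    ((hcont 0 (left_mem_Icc.2 zero_le_one)).tendsto.comp ha)
  rw [intervalIntegral.integral_same, sub_zero, hf.intervalIntegral] at hlim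
  refine hlim.congr' ?_
  filter_upwards [hF, (tendsto_nhdsWithin_iff.1 ha).2, (tendsto_nhdsWithin_iff.1 hb).2]
    with i hFi hai hbi
  rw [Function.comp_apply, Function.comp_apply,
    intervalIntegral.integral_interval_sub_left (hsub _ hbi) (hsub _ hai)]
  exact intervalIntegral.integral_eq_sub_of_hasDerivAt hFi ((hsub _ hai).symm.trans (hsub _ hbi))

section LensPrimitive

variable {F f : ℂ → ℂ} {t : ℝ}

theorem hasDerivAt_comp_inv_one_sub (hF : ∀ z ∈ lensDisc, HasDerivAt F (f z) z) {w : ℂ}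
    (hw : w.re < w.im) :
    HasDerivAt (fun w => F (1 - w)⁻¹) (f (1 - w)⁻¹ / (1 - w) ^ 2) w := by
  have hne : 1 - w ≠ 0 := one_sub_ne_zero_of_re_lt_im hw
  have hinv : HasDerivAt (fun w : ℂ => (1 - w)⁻¹) (1 / (1 - w) ^ 2) w :=
    (((hasDerivAt_id w).const_sub 1).inv hne).congr_deriv (by
      rw [neg_neg, id])
  refine ((hF _ (inv_one_sub_mem_lensDisc hw)).comp w hinv).congr_deriv ?_
  rw [mul_one_div]

theorem hasDerivAt_comp_mul_ofReal (c : ℂ) (hF : HasDerivAt F (f (c * t)) (c * t)) :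
    HasDerivAt (fun t : ℝ => F (c * t)) (c * f (c * t)) t := by
  have hmul : HasDerivAt (fun t : ℝ => c * (t : ℂ)) c t := by
    simpa using (Complex.ofRealCLM.hasDerivAt (x := t)).const_mul c
  exact hF.scomp t hmul

theorem tendsto_primitive_sixthRoot_mul_sub (hF : ∀ z ∈ lensDisc, HasDerivAt F (f z) z)
    (h0 : Tendsto (fun x => x * f x) (𝓝[lensDisc] 0) (𝓝 0)) :
    Tendsto (fun ε : ℝ => F (sixthRoot * ε) - F ε) (𝓝[>] 0) (𝓝 0) := by
  have hI : ∀ᶠ ε : ℝ in 𝓝[>] 0, ε ∈ Ioo (0 : ℝ) 1 := Ioo_mem_nhdsGT zero_lt_one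
  have h := tendsto_sub_of_tendsto_mul_deriv (u := 1) (v := sixthRoot) (convex_ball _ _)
    (fun z hz => (hF z hz).hasDerivWithinAt) h0 ?_
    (hI.mono fun ε hε => by rw [one_mul]; exact ofReal_mem_lensDisc hε)
    (hI.mono fun ε hε => sixthRoot_mul_mem_lensDisc hε.1 hε.2.le)
  · simpa only [one_mul] using h
  · rintro ⟨a, b, ha, _, hab, h⟩
    have hre := congrArg Complex.re h
    simp only [Complex.add_re, Complex.real_smul, Complex.re_ofReal_mul, Complex.one_re,
      sixthRoot_re, Complex.zero_re] at hre
    linarith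

theorem tendsto_primitive_inv_one_sub_sixthRoot_mul_sub
    (hF : ∀ z ∈ lensDisc, HasDerivAt F (f z) z)
    (h1 : Tendsto (fun x => (1 - x) * f x) (𝓝[lensDisc] 1) (𝓝 0)) :
    Tendsto (fun ε : ℝ => F (1 - sixthRoot * ε)⁻¹ - F (1 + ε)⁻¹) (𝓝[>] 0) (𝓝 0) := by
  have hlim : Tendsto (fun w : ℂ => w * (f (1 - w)⁻¹ / (1 - w) ^ 2)) (𝓝[{w | w.re < w.im}] 0)
      (𝓝 0) := by
    have hσ : Tendsto (fun w : ℂ => (1 - w)⁻¹) (𝓝[{w | w.re < w.im}] 0) (𝓝[lensDisc] 1) := by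
      refine tendsto_nhdsWithin_iff.2 ⟨?_, eventually_mem_nhdsWithin.mono fun w hw =>
        inv_one_sub_mem_lensDisc hw⟩
      have hc : ContinuousAt (fun w : ℂ => (1 - w)⁻¹) 0 := by fun_prop (disch := norm_num)
      exact (hc.tendsto.mono_left nhdsWithin_le_nhds).trans (by norm_num)
    have hmul := (h1.comp hσ).neg.mul (hσ.mono_right nhdsWithin_le_nhds)
    rw [neg_zero, zero_mul] at hmul
    refine hmul.congr' (eventually_mem_nhdsWithin.mono fun w hw => ?_)
    have hne : 1 - w ≠ 0 := one_sub_ne_zero_of_re_lt_im hw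
    simp only [Function.comp_apply]
    field_simp
    ring
  have hpos : ∀ᶠ ε : ℝ in 𝓝[>] 0, 0 < ε := self_mem_nhdsWithin
  have h := tendsto_sub_of_tendsto_mul_deriv (F := fun w => F (1 - w)⁻¹) (u := -1)
    (v := sixthRoot) convex_setOf_re_lt_im
    (fun w hw => (hasDerivAt_comp_inv_one_sub hF hw).hasDerivWithinAt) hlim ?_
    (hpos.mono fun ε hε => by simpa using hε)
    (hpos.mono fun ε hε => sixthRoot_mul_re_lt_im hε)
  · simpa only [neg_one_mul, sub_neg_eq_add] using h
  · rintro ⟨a, b, _, hb, hab, h⟩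
    have hre := congrArg Complex.re h
    have him := congrArg Complex.im h
    simp only [Complex.add_re, Complex.add_im, Complex.real_smul, Complex.re_ofReal_mul,
      Complex.im_ofReal_mul, Complex.neg_re, Complex.neg_im, Complex.one_re, Complex.one_im,
      sixthRoot_re, sixthRoot_im, Complex.zero_re, Complex.zero_im] at hre him
    nlinarith [one_lt_sqrt_three]

end LensPrimitive

theorem HasUnitIntegral.eq_sub_of_differentiableOn_lensDisc {f : ℂ → ℂ} {a b c : ℂ}
    (hf : DifferentiableOn ℂ f lensDisc)
    (h0 : Tendsto (fun x => x * f x) (𝓝[lensDisc] 0) (𝓝 0))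
    (h1 : Tendsto (fun x => (1 - x) * f x) (𝓝[lensDisc] 1) (𝓝 0))
    (hunit : HasUnitIntegral (fun t => f t) a)
    (hray : HasUnitIntegral (fun t => sixthRoot * f (sixthRoot * t)) b)
    (harc : HasUnitIntegral
      (fun t => sixthRoot * (f (1 - sixthRoot * t)⁻¹ / (1 - sixthRoot * t) ^ 2)) c) :
    a = b - c := by
  obtain ⟨F, hF⟩ := hf.isExactOn_ball
  replace hF : ∀ z ∈ lensDisc, HasDerivAt F (f z) z := hF
  have hI : ∀ᶠ ε : ℝ in 𝓝[>] 0, ε ∈ Ioo (0 : ℝ) 1 := Ioo_mem_nhdsGT zero_lt_one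
  have hinv : ∀ ε ∈ Ioo (0 : ℝ) 1, (1 + ε)⁻¹ ∈ Ioo (0 : ℝ) 1 := fun ε hε =>
    ⟨inv_pos.2 (by linarith [hε.1]), inv_lt_one_of_one_lt₀ (by linarith [hε.1])⟩
  have hzero : Tendsto (fun ε : ℝ => ε) (𝓝[>] 0) (𝓝[Icc 0 1] 0) :=
    tendsto_nhdsWithin_iff.2 ⟨nhdsWithin_le_nhds, hI.mono fun ε hε => Ioo_subset_Icc_self hε⟩
  have hone : Tendsto (fun _ : ℝ => (1 : ℝ)) (𝓝[>] 0) (𝓝[Icc 0 1] 1) :=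
    tendsto_nhdsWithin_iff.2 ⟨tendsto_const_nhds, .of_forall fun _ => by simp⟩
  have hone' : Tendsto (fun ε : ℝ => (1 + ε)⁻¹) (𝓝[>] 0) (𝓝[Icc 0 1] 1) := by
    refine tendsto_nhdsWithin_iff.2 ⟨?_, hI.mono fun ε hε => Ioo_subset_Icc_self (hinv ε hε)⟩
    have hc : ContinuousAt (fun ε : ℝ => (1 + ε)⁻¹) 0 := by fun_prop (disch := norm_num)
    exact (hc.tendsto.mono_left nhdsWithin_le_nhds).trans (by norm_num)
  have hIcc : ∀ ε ∈ Ioo (0 : ℝ) 1, ∀ t ∈ uIcc ε 1, 0 < t ∧ t ≤ 1 := fun ε hε t ht => by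
    rw [uIcc_of_le hε.2.le] at ht
    exact ⟨hε.1.trans_le ht.1, ht.2⟩
  have hlimunit := hunit.tendsto_sub (F := fun t => F t) hzero hone' <| hI.mono fun ε hε t ht =>
    (hF _ (ofReal_mem_lensDisc (ordConnected_Ioo.uIcc_subset hε (hinv ε hε) ht))).comp_ofReal
  have hlimray := hray.tendsto_sub hzero hone <| hI.mono fun ε hε t ht =>
    hasDerivAt_comp_mul_ofReal sixthRoot (hF _ (sixthRoot_mul_mem_lensDisc
      (hIcc ε hε t ht).1 (hIcc ε hε t ht).2))
  have hlimarc := harc.tendsto_sub hzero hone <| hI.mono fun ε hε t ht =>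
    hasDerivAt_comp_mul_ofReal (F := fun w => F (1 - w)⁻¹)
      (f := fun w => f (1 - w)⁻¹ / (1 - w) ^ 2) sixthRoot
      (hasDerivAt_comp_inv_one_sub hF (sixthRoot_mul_re_lt_im (hIcc ε hε t ht).1))
  have hchords := (tendsto_primitive_inv_one_sub_sixthRoot_mul_sub hF h1).sub
    (tendsto_primitive_sixthRoot_mul_sub hF h0)
  have hclosed := tendsto_nhds_unique (((hlimray.sub hlimarc).sub hlimunit).congr fun ε => ?_)
    hchords
  · linear_combination -hclosed
  · rw [Complex.ofReal_one, mul_one, inv_one_sub_sixthRoot]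
    push_cast
    ring

end Contour

section LogForm

/-- The form `(log x + α)^i ((log (1 - x) + β)^j - β^j) / x`, of which `shiftedNielsen` is the
integral along a segment from `0`; subtracting `β^j` removes the pole at the origin. -/
noncomputable def logForm (α β : ℂ) (i j : ℕ) (x : ℂ) : ℂ :=
  (Complex.log x + α) ^ i * ((Complex.log (1 - x) + β) ^ j - β ^ j) / x

theorem differentiableOn_logForm (α β : ℂ) (i j : ℕ) :
    DifferentiableOn ℂ (logForm α β i j) lensDisc := fun x hx => by
  have hslit := mem_slitPlane_of_mem_lensDisc hx
  have hslit' := one_sub_mem_slitPlane_of_mem_lensDisc hx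
  refine DifferentiableAt.differentiableWithinAt (.div ?_ differentiableAt_id
    (Complex.slitPlane_ne_zero hslit))
  exact (((Complex.differentiableAt_log hslit).add_const α).pow i).mul
    (((((differentiableAt_id.const_sub 1).clog hslit').add_const β).pow j).sub_const _)

theorem tendsto_mul_log_add_pow (c : ℂ) (n : ℕ) :
    Tendsto (fun x => x * (Complex.log x + c) ^ n) (𝓝[≠] 0) (𝓝 0) := by
  have hgrowth : HasSubpowerGrowth fun t : ℝ => ((-Real.log t + (Real.pi + ‖c‖) : ℝ) : ℂ) ^ n :=
    (((HasSubpowerGrowth.const 0).sub hasSubpowerGrowth_log).add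
      (.const ((Real.pi + ‖c‖ : ℝ) : ℂ))).pow n |>.of_norm_le fun t _ => by
        rw [zero_sub]
        push_cast
        rfl
  have hlim := (hgrowth.tendsto_ofReal_mul.comp (tendsto_norm_nhdsNE_zero (E := ℂ))).norm
  rw [norm_zero] at hlim
  refine squeeze_zero_norm' ?_ hlim
  have hlt : ∀ᶠ x : ℂ in 𝓝[≠] 0, ‖x‖ < 1 :=
    nhdsWithin_le_nhds ((continuous_norm (E := ℂ)).tendsto' 0 0 norm_zero
      |>.eventually_lt_const one_pos)
  filter_upwards [hlt] with x hx
  have hlog : ‖Complex.log x + c‖ ≤ -Real.log ‖x‖ + (Real.pi + ‖c‖) := by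
    have h := Complex.norm_le_abs_re_add_abs_im (Complex.log x)
    rw [Complex.log_re, Complex.log_im,
      abs_of_nonpos (Real.log_nonpos (norm_nonneg x) hx.le)] at h
    linarith [norm_add_le (Complex.log x) c, Complex.abs_arg_le_pi x]
  rw [Function.comp_apply, norm_mul, norm_mul, norm_pow, norm_pow, Complex.norm_real, norm_norm,
    Complex.norm_real]
  gcongr
  exact hlog.trans (le_abs_self _)

theorem tendsto_mul_logForm_zero (α β : ℂ) (i j : ℕ) :
    Tendsto (fun x => x * logForm α β i j x) (𝓝[lensDisc] 0) (𝓝 0) := by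
  have hsub : lensDisc ⊆ {0}ᶜ := fun x hx =>
    Complex.slitPlane_ne_zero (mem_slitPlane_of_mem_lensDisc hx)
  have hderiv : DifferentiableAt ℂ (fun x : ℂ => (Complex.log (1 - x) + β) ^ j) 0 :=
    ((((differentiableAt_id.const_sub 1).clog (by simp)).add_const β).pow j)
  have hlim := ((tendsto_mul_log_add_pow α i).mul
    (hasDerivAt_iff_tendsto_slope.1 hderiv.hasDerivAt)).mono_left (nhdsWithin_mono 0 hsub)
  rw [zero_mul] at hlim
  refine hlim.congr fun x => ?_
  simp only [slope_def_field, logForm, sub_zero, Complex.log_one, zero_add]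
  ring

theorem tendsto_one_sub_mul_logForm_one (α β : ℂ) (i j : ℕ) :
    Tendsto (fun x => (1 - x) * logForm α β i j x) (𝓝[lensDisc] 1) (𝓝 0) := by
  have hone : Tendsto (fun x : ℂ => 1 - x) (𝓝[lensDisc] 1) (𝓝 0) :=
    ((continuous_const.sub continuous_id).tendsto' 1 0 (sub_self 1)).mono_left nhdsWithin_le_nhds
  have hone' : Tendsto (fun x : ℂ => 1 - x) (𝓝[lensDisc] 1) (𝓝[≠] 0) :=
    tendsto_nhdsWithin_iff.2 ⟨hone, eventually_mem_nhdsWithin.mono fun x hx =>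
      Complex.slitPlane_ne_zero (one_sub_mem_slitPlane_of_mem_lensDisc hx)⟩
  have hcont : ContinuousAt (fun x : ℂ => (Complex.log x + α) ^ i / x) 1 := by
    fun_prop (disch := simp)
  have hlim := (((tendsto_mul_log_add_pow β j).comp hone').sub (hone.mul_const (β ^ j))).mul
    (hcont.tendsto.mono_left nhdsWithin_le_nhds)
  rw [zero_mul, sub_zero, zero_mul] at hlim
  refine hlim.congr fun x => ?_
  rw [Function.comp_apply, logForm]
  ring

end LogForm

section Triangle

/-- The value of `∫_0^1 log^m t · (log (1 - ω t) + logSixthRoot)^n · ω dt / (1 - ω t)`, where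
`ω = sixthRoot`. -/
noncomputable def dlogMoment : ℕ → ℕ → ℂ
  | 0, n => logSixthRoot ^ (n + 1) / (n + 1)
  | m + 1, n => (m + 1) / (n + 1) * shiftedNielsen sixthRoot 0 logSixthRoot m (n + 1)

theorem hasUnitIntegral_dlogMoment (m n : ℕ) :
    HasUnitIntegral (fun t => (Real.log t : ℂ) ^ m *
      (Complex.log (1 - sixthRoot * t) + logSixthRoot) ^ n * (sixthRoot / (1 - sixthRoot * t)))
      (dlogMoment m n) := by
  cases m with
  | zero =>
    have h := hasUnitIntegral_log_one_sub_mul_pow_mul_dlog norm_sixthRoot.le sixthRoot_re.le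
      logSixthRoot n
    rw [log_one_sub_sixthRoot, neg_add_cancel, zero_pow n.succ_ne_zero, sub_zero] at h
    simpa only [pow_zero, one_mul, dlogMoment] using h
  | succ m => exact hasUnitIntegral_log_pow_succ_mul_dlog norm_sixthRoot.le logSixthRoot m n

theorem hasUnitIntegral_logForm_arc (i j : ℕ) :
    HasUnitIntegral
      (fun t => sixthRoot * (logForm (-logSixthRoot) logSixthRoot i j (1 - sixthRoot * t)⁻¹ /
        (1 - sixthRoot * t) ^ 2))
      ((-1) ^ i * (∑ k ∈ Finset.range (j + 1),
        j.choose k * (-1) ^ (j - k) * dlogMoment k (i + (j - k)) -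
          logSixthRoot ^ j * dlogMoment 0 i)) := by
  refine ((((HasUnitIntegral.sum _ fun k _ => (hasUnitIntegral_dlogMoment k
    (i + (j - k))).const_mul (j.choose k * (-1) ^ (j - k))).sub
      ((hasUnitIntegral_dlogMoment 0 i).const_mul (logSixthRoot ^ j))).const_mul
        ((-1) ^ i))).congr fun t ht => ?_
  have hne := Complex.slitPlane_ne_zero (one_sub_sixthRoot_mul_mem_slitPlane ht.2.le)
  rw [logForm, log_inv_one_sub_sixthRoot_mul ht.2.le,
    log_one_sub_inv_one_sub_sixthRoot_mul ht.1 ht.2.le]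
  set L := (Real.log t : ℂ)
  set ℓ := Complex.log (1 - sixthRoot * t) + logSixthRoot with hℓ
  have hbinom : ∑ k ∈ Finset.range (j + 1), (j.choose k * (-1) ^ (j - k) : ℂ) *
      (L ^ k * ℓ ^ (i + (j - k)) * (sixthRoot / (1 - sixthRoot * t))) =
      (L - ℓ) ^ j * ℓ ^ i * (sixthRoot / (1 - sixthRoot * t)) := by
    rw [sub_eq_add_neg L, add_pow, Finset.sum_mul, Finset.sum_mul]
    refine Finset.sum_congr rfl fun k _ => ?_
    rw [neg_pow ℓ]
    ring
  have hlog : -Complex.log (1 - sixthRoot * t) + -logSixthRoot = -1 * ℓ := by rw [hℓ]; ring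
  have hlog' : L - 2 * logSixthRoot - Complex.log (1 - sixthRoot * t) + logSixthRoot = L - ℓ := by
    rw [hℓ]
    ring
  rw [hbinom, hlog, hlog', mul_pow]
  field_simp

theorem shiftedNielsen_one_eq_sub_arc (i j : ℕ) :
    shiftedNielsen 1 (-logSixthRoot) logSixthRoot i j =
      shiftedNielsen sixthRoot 0 logSixthRoot i j -
        (-1) ^ i * (∑ k ∈ Finset.range (j + 1),
          j.choose k * (-1) ^ (j - k) * dlogMoment k (i + (j - k)) -
            logSixthRoot ^ j * dlogMoment 0 i) := by
  refine HasUnitIntegral.eq_sub_of_differentiableOn_lensDisc (differentiableOn_logForm _ _ i j)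
    (tendsto_mul_logForm_zero _ _ i j) (tendsto_one_sub_mul_logForm_one _ _ i j) ?_ ?_
    (hasUnitIntegral_logForm_arc i j)
  · refine (hasUnitIntegral_shiftedNielsen norm_one.le _ _ i j).congr fun t ht => ?_
    rw [logForm, one_mul, Complex.ofReal_log ht.1.le]
  · refine (hasUnitIntegral_shiftedNielsen norm_sixthRoot.le _ _ i j).congr fun t ht => ?_
    have hω := sixthRoot_ne_zero
    rw [logForm, log_sixthRoot_mul ht.1, add_neg_cancel_right, add_zero]
    field_simp

theorem shiftedNielsen_sixthRoot_relation :
    2 * shiftedNielsen sixthRoot 0 logSixthRoot 2 3 -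
        3 * shiftedNielsen sixthRoot 0 logSixthRoot 4 1 =
      -4 * shiftedNielsen 1 (-logSixthRoot) logSixthRoot 4 1 +
        2 * shiftedNielsen 1 (-logSixthRoot) logSixthRoot 3 2 -
        shiftedNielsen 1 (-logSixthRoot) logSixthRoot 0 5 / 5 + 28 / 15 * logSixthRoot ^ 6 := by
  -- For `Q = 4A⁴B - 2A³B² + B⁵/5` the `ω`-terms are governed by
  -- `Q_B(A, B) - Q_B(-B, A - B) = 3A⁴ - 6A²B²`, the `B`-derivative of `3A⁴B - 2A²B³`.
  have r41 := shiftedNielsen_one_eq_sub_arc 4 1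
  have r32 := shiftedNielsen_one_eq_sub_arc 3 2
  have r05 := shiftedNielsen_one_eq_sub_arc 0 5
  norm_num [Finset.sum_range_succ, Nat.choose, dlogMoment] at r41 r32 r05
  linear_combination 4 * r41 - 2 * r32 + 1 / 5 * r05

theorem shiftedNielsen_one_relation :
    shiftedNielsen 1 (-logSixthRoot) logSixthRoot 4 1 -
        shiftedNielsen 1 (-logSixthRoot) logSixthRoot 3 2 +
        shiftedNielsen 1 (-logSixthRoot) logSixthRoot 2 3 -
        shiftedNielsen 1 (-logSixthRoot) logSixthRoot 1 4 / 2 +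
        shiftedNielsen 1 (-logSixthRoot) logSixthRoot 0 5 / 5 =
      27 / 20 * logSixthRoot ^ 6 := by
  -- `Q = A⁴B - A³B² + A²B³ - AB⁴/2 + B⁵/5` has `Q_B = (A² - AB + B²)²`, which is invariant under
  -- `(A, B) ↦ (-B, A - B)`; hence the `ω`-terms cancel.
  have r41 := shiftedNielsen_one_eq_sub_arc 4 1
  have r32 := shiftedNielsen_one_eq_sub_arc 3 2
  have r23 := shiftedNielsen_one_eq_sub_arc 2 3
  have r14 := shiftedNielsen_one_eq_sub_arc 1 4
  have r05 := shiftedNielsen_one_eq_sub_arc 0 5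
  norm_num [Finset.sum_range_succ, Nat.choose, dlogMoment] at r41 r32 r23 r14 r05
  linear_combination r41 - r32 + r23 - 1 / 2 * r14 + 1 / 5 * r05

end Triangle

section ValuesAtOne

theorem riemannZeta_six : riemannZeta 6 = (Real.pi : ℂ) ^ 6 / 945 := by
  have hbernoulli : bernoulli 6 = 1 / 42 := by
    rw [bernoulli_eq_bernoulli'_of_ne_one (by norm_num), bernoulli'_def]
    norm_num [Finset.sum_range_succ, Nat.choose,
      bernoulli'_eq_zero_of_odd (n := 5) (by decide) (by norm_num)]
  have h := riemannZeta_two_mul_nat (k := 3) (by norm_num)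
  norm_num [hbernoulli, Nat.factorial] at h
  rw [h]
  ring

theorem nielsenPolylog_one_right_one {n : ℕ} (hn : n ≠ 0) :
    nielsenPolylog n 1 1 = riemannZeta (n + 1) := by
  obtain ⟨n, rfl⟩ := Nat.exists_eq_succ_of_ne_zero hn
  rw [Nat.succ_eq_add_one, nielsenPolylog_add_one_one norm_one.le,
    classicalPolylog_one_eq_riemannZeta]
  push_cast
  ring_nf

theorem nielsenPolylog_one_left_one {p : ℕ} (hp : p ≠ 0) :
    nielsenPolylog 1 p 1 = riemannZeta (p + 1) := by
  obtain ⟨p, rfl⟩ := Nat.exists_eq_succ_of_ne_zero hp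
  rw [← nielsenPolylog_one_right_one hp]
  exact nielsenPolylog_one_symm 0 p

theorem nielsenPolylog_two_two_one :
    nielsenPolylog 2 2 1 = (3 * riemannZeta 4 - riemannZeta 2 ^ 2) / 2 := by
  rw [nielsenPolylog_add_one_two_one 1]
  norm_num [Finset.sum_range_succ]
  ring

theorem nielsenPolylog_three_two_one :
    nielsenPolylog 3 2 1 = 2 * riemannZeta 5 - riemannZeta 2 * riemannZeta 3 := by
  rw [nielsenPolylog_add_one_two_one 2]
  norm_num [Finset.sum_range_succ]
  ring

theorem nielsenPolylog_four_two_one :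
    nielsenPolylog 4 2 1 = 3 / 4 * riemannZeta 6 - 1 / 2 * riemannZeta 3 ^ 2 := by
  rw [nielsenPolylog_add_one_two_one 3]
  norm_num [Finset.sum_range_succ]
  rw [riemannZeta_two, riemannZeta_four, riemannZeta_six]
  ring

theorem I_mul_pi_eq_logSixthRoot : Complex.I * Real.pi = 3 * logSixthRoot := by
  rw [logSixthRoot]
  ring

theorem pi_sq_eq_logSixthRoot : (Real.pi : ℂ) ^ 2 = -9 * logSixthRoot ^ 2 := by
  linear_combination (-Complex.I * Real.pi - 3 * logSixthRoot) * I_mul_pi_eq_logSixthRoot +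
    (Real.pi : ℂ) ^ 2 * Complex.I_sq

theorem riemannZeta_two_eq_logSixthRoot : riemannZeta 2 = -3 / 2 * logSixthRoot ^ 2 := by
  rw [riemannZeta_two, pi_sq_eq_logSixthRoot]
  ring

theorem riemannZeta_four_eq_logSixthRoot : riemannZeta 4 = 9 / 10 * logSixthRoot ^ 4 := by
  rw [riemannZeta_four, show 4 = 2 * 2 from rfl, pow_mul (Real.pi : ℂ), pi_sq_eq_logSixthRoot]
  ring

theorem riemannZeta_six_eq_logSixthRoot : riemannZeta 6 = -27 / 35 * logSixthRoot ^ 6 := by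
  rw [riemannZeta_six, show 6 = 2 * 3 from rfl, pow_mul (Real.pi : ℂ), pi_sq_eq_logSixthRoot]
  ring

theorem nielsenPolylog_three_three_one :
    nielsenPolylog 3 3 1 = 23 / 16 * riemannZeta 6 - riemannZeta 3 ^ 2 := by
  have hsymm₂₃ : nielsenPolylog 2 3 1 = nielsenPolylog 3 2 1 := nielsenPolylog_one_symm 1 2
  have hsymm₂₄ : nielsenPolylog 2 4 1 = nielsenPolylog 4 2 1 := nielsenPolylog_one_symm 1 3
  have h := shiftedNielsen_one_relation
  simp only [shiftedNielsen_eq_sum norm_one.le, Finset.sum_range_succ, Finset.sum_range_zero] at h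
  norm_num [Nat.choose, Nat.factorial, nielsenPolylog_one_right_one, nielsenPolylog_one_left_one,
    hsymm₂₃, hsymm₂₄, nielsenPolylog_two_two_one, nielsenPolylog_three_two_one,
    nielsenPolylog_four_two_one, riemannZeta_two_eq_logSixthRoot,
    riemannZeta_four_eq_logSixthRoot, riemannZeta_six_eq_logSixthRoot] at h
  rw [riemannZeta_six_eq_logSixthRoot]
  linear_combination -1 / 12 * h

end ValuesAtOne

section ValueAtSixthRoot

theorem nielsenPolylog_three_three_sixthRoot :
    nielsenPolylog 3 3 sixthRoot =
        3 * classicalPolylog 6 sixthRoot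
          - 1 / 2 * riemannZeta 3 ^ 2
          - 1829 / 1944 * riemannZeta 6
          + 1 / 3 * Complex.I * (Real.pi : ℂ) * (nielsenPolylog 3 2 sixthRoot - 2 * riemannZeta 5)
          + 1 / 3 * riemannZeta 2 * classicalPolylog 4 sixthRoot
          + 1 / 324 * (2 * Complex.I * (Real.pi : ℂ)) ^ 3 * riemannZeta 3 := by
  have hLi₄ : nielsenPolylog 3 1 sixthRoot = classicalPolylog 4 sixthRoot :=
    nielsenPolylog_add_one_one norm_sixthRoot.le 2
  have hLi₆ : nielsenPolylog 5 1 sixthRoot = classicalPolylog 6 sixthRoot :=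
    nielsenPolylog_add_one_one norm_sixthRoot.le 4
  have h := shiftedNielsen_sixthRoot_relation
  simp only [shiftedNielsen_eq_sum norm_one.le, shiftedNielsen_eq_sum norm_sixthRoot.le,
    Finset.sum_range_succ, Finset.sum_range_zero] at h
  norm_num [Nat.choose, Nat.factorial, nielsenPolylog_one_right_one, nielsenPolylog_one_left_one,
    hLi₄, hLi₆, nielsenPolylog_two_two_one, nielsenPolylog_three_two_one,
    nielsenPolylog_four_two_one, riemannZeta_two_eq_logSixthRoot,
    riemannZeta_four_eq_logSixthRoot, riemannZeta_six_eq_logSixthRoot] at h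
  rw [mul_assoc (1 / 3), mul_assoc 2 Complex.I, I_mul_pi_eq_logSixthRoot,
    riemannZeta_two_eq_logSixthRoot, riemannZeta_six_eq_logSixthRoot]
  linear_combination -1 / 24 * h

end ValueAtSixthRoot

section ArgumentNegOne

variable {f H : ℝ → ℂ} {v : ℂ}

theorem HasUnitIntegral.integral_half_one_add_comp_one_sub (hf : HasUnitIntegral f v) :
    IntegrableOn (fun s => f s + f (1 - s)) (Ioo (1 / 2) 1) ∧
      ∫ s in Ioo (1 / 2 : ℝ) 1, (f s + f (1 - s)) = v := by
  have hhalf : (1 / 2 : ℝ) ∈ uIcc (0 : ℝ) 1 := by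
    rw [uIcc_of_le zero_le_one]
    constructor <;> norm_num
  have hleft := hf.intervalIntegrable.mono_set (uIcc_subset_uIcc_left hhalf)
  have hright := hf.intervalIntegrable.mono_set (uIcc_subset_uIcc_right hhalf)
  have hreflect : IntervalIntegrable (fun s => f (1 - s)) volume (1 / 2) 1 := by
    have h := (hleft.comp_sub_left 1).symm
    norm_num at h
    simpa using h
  have hle : (1 / 2 : ℝ) ≤ 1 := by norm_num
  refine ⟨(intervalIntegrable_iff_integrableOn_Ioo_of_le hle).1 (hright.add hreflect), ?_⟩
  rw [← integral_Ioc_eq_integral_Ioo, ← intervalIntegral.integral_of_le hle,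
    intervalIntegral.integral_add hright hreflect, intervalIntegral.integral_comp_sub_left,
    sub_self, show (1 : ℝ) - 1 / 2 = 1 / 2 by norm_num, add_comm,
    intervalIntegral.integral_add_adjacent_intervals hleft hright, hf.intervalIntegral]

theorem image_inv_one_add_Ioo : (fun t : ℝ => (1 + t)⁻¹) '' Ioo 0 1 = Ioo (1 / 2) 1 := by
  ext s
  constructor
  · rintro ⟨t, ht, rfl⟩
    have hpos : 0 < 1 + t := by linarith [ht.1]
    exact ⟨by rw [one_div]; exact inv_strictAnti₀ hpos (by linarith [ht.2]),
      inv_lt_one_of_one_lt₀ (by linarith [ht.1])⟩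
  · intro hs
    have hpos : 0 < s := by linarith [hs.1]
    refine ⟨s⁻¹ - 1, ⟨?_, ?_⟩, by simp only [add_sub_cancel, inv_inv]⟩
    · linarith [(one_lt_inv₀ hpos).2 hs.2]
    · have h := inv_strictAnti₀ one_half_pos hs.1
      norm_num at h
      linarith

theorem HasUnitIntegral.comp_inv_one_add (hH : HasUnitIntegral (fun s => H s / s) v)
    (hsymm : ∀ s ∈ Ioo (0 : ℝ) 1, H (1 - s) = H s) :
    HasUnitIntegral (fun t => H (1 + t)⁻¹ / t) v := by
  obtain ⟨hint, hval⟩ := hH.integral_half_one_add_comp_one_sub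
  have hderiv : ∀ t ∈ Ioo (0 : ℝ) 1,
      HasDerivWithinAt (fun t : ℝ => (1 + t)⁻¹) (-1 / (1 + t) ^ 2) (Ioo 0 1) t := fun t ht =>
    (((hasDerivAt_id t).const_add 1).inv (by simp only [id]; linarith [ht.1])).hasDerivWithinAt
  have hinj : InjOn (fun t : ℝ => (1 + t)⁻¹) (Ioo 0 1) := fun a _ b _ h =>
    add_left_cancel (inv_injective h)
  have hsubst : EqOn (fun t => |-1 / (1 + t) ^ 2| • (H (1 + t)⁻¹ / ((1 + t)⁻¹ : ℝ) +
      H (1 - (1 + t)⁻¹) / (1 - (1 + t)⁻¹ : ℝ))) (fun t => H (1 + t)⁻¹ / t) (Ioo 0 1) := by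
    intro t ht
    have hpos : 0 < 1 + t := by linarith [ht.1]
    have hs : (1 + t)⁻¹ ∈ Ioo (0 : ℝ) 1 :=
      ⟨inv_pos.2 hpos, inv_lt_one_of_one_lt₀ (by linarith [ht.1])⟩
    have ht0 : (t : ℂ) ≠ 0 := Complex.ofReal_ne_zero.2 ht.1.ne'
    have ht1 : (1 + t : ℂ) ≠ 0 := mod_cast hpos.ne'
    beta_reduce
    rw [hsymm _ hs, neg_div, abs_neg, abs_of_pos (by positivity), Complex.real_smul]
    push_cast
    have hsub : 1 - (1 + t : ℂ)⁻¹ = t / (1 + t) := by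
      field_simp
      ring
    rw [hsub]
    field_simp
    ring
  rw [← image_inv_one_add_Ioo] at hint hval
  rw [integrableOn_image_iff_integrableOn_abs_deriv_smul measurableSet_Ioo hderiv hinj] at hint
  rw [integral_image_eq_integral_abs_deriv_smul measurableSet_Ioo hderiv hinj] at hval
  exact ⟨hint.congr_fun hsubst measurableSet_Ioo,
    (setIntegral_congr_fun measurableSet_Ioo hsubst).symm.trans hval⟩

theorem classicalPolylog_six_neg_one : classicalPolylog 6 (-1) = -31 / 32 * riemannZeta 6 := by
  have h := classicalPolylog_add_classicalPolylog_neg norm_one.le (m := 6) (by norm_num)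
  have hone := classicalPolylog_one_eq_riemannZeta 4
  norm_num at h hone
  rw [hone] at h
  linear_combination h

theorem nielsenPolylog_neg_one_relation :
    2 * nielsenPolylog 3 3 (-1) - 3 * nielsenPolylog 4 2 (-1) + 2 * nielsenPolylog 5 1 (-1) =
      nielsenPolylog 3 3 1 - nielsenPolylog 4 2 1 - 2 * nielsenPolylog 5 1 1 := by
  -- At `s = 1 / (1 + t)` the symmetric factor `(A - B) ^ 2` is `log t ^ 2`; it removes the terms
  -- `S_{1,5}(-1)` and `S_{2,4}(-1)`.
  let P : ℂ → ℂ → ℂ := fun A B => A * B * (A + B) * (A - B) ^ 2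
  have hone : HasUnitIntegral
      (fun s => P (Real.log s) (Real.log (1 - s)) / s) _ :=
    ((((hasUnitIntegral_nielsenPolylog norm_one.le 4 0).sub
      (hasUnitIntegral_nielsenPolylog norm_one.le 3 1)).sub
      (hasUnitIntegral_nielsenPolylog norm_one.le 2 2)).add
      (hasUnitIntegral_nielsenPolylog norm_one.le 1 3)).congr fun s hs => by
        rw [Complex.ofReal_log (one_sub_mem_Ioo_zero_one hs).1.le, one_mul]
        push_cast
        ring
  have hneg : HasUnitIntegral
      (fun t => P (Real.log (1 + t)⁻¹) (Real.log (1 - (1 + t)⁻¹)) / t) _ :=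
    ((((hasUnitIntegral_nielsenPolylog (z := -1) (by simp) 3 1).const_mul 3).sub
      (hasUnitIntegral_nielsenPolylog (z := -1) (by simp) 4 0)).sub
      ((hasUnitIntegral_nielsenPolylog (z := -1) (by simp) 2 2).const_mul 2)).congr fun t ht => by
        have hpos : 0 < 1 + t := by linarith [ht.1]
        have hsub : 1 - (1 + t)⁻¹ = t / (1 + t) := by
          field_simp
          ring
        have hlog : Complex.log (1 - -1 * t) = Real.log (1 + t) := by
          rw [Complex.ofReal_log hpos.le]
          push_cast
          ring_nf
        rw [hsub, Real.log_inv, Real.log_div ht.1.ne' hpos.ne', hlog]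
        push_cast
        ring
  have h := (hone.comp_inv_one_add (H := fun s => P (Real.log s) (Real.log (1 - s)))
    fun s _ => by simp only [P, sub_sub_cancel]; ring).unique hneg
  have hsymm : nielsenPolylog 2 4 1 = nielsenPolylog 4 2 1 := nielsenPolylog_one_symm 1 3
  norm_num [Nat.factorial, hsymm] at h
  linear_combination -1 / 12 * h

theorem nielsenPolylog_three_three_neg_one :
    nielsenPolylog 3 3 (-1) =
      3 / 2 * nielsenPolylog 4 2 (-1) + 5 / 16 * riemannZeta 6 - 1 / 4 * riemannZeta 3 ^ 2 := by
  have hLi₆ : nielsenPolylog 5 1 (-1) = -31 / 32 * riemannZeta 6 := by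
    rw [nielsenPolylog_add_one_one (by simp) 4, classicalPolylog_six_neg_one]
  have hζ₆ : nielsenPolylog 5 1 1 = riemannZeta 6 := by
    rw [nielsenPolylog_one_right_one (by norm_num)]
    norm_num
  have h := nielsenPolylog_neg_one_relation
  rw [hLi₆, hζ₆, nielsenPolylog_three_three_one, nielsenPolylog_four_two_one] at h
  linear_combination 1 / 2 * h

end ArgumentNegOne

theorem mainTheorem11 :
    (nielsenPolylog 3 3 (-1) =
      3 / 2 * nielsenPolylog 4 2 (-1) + 5 / 16 * riemannZeta 6 - 1 / 4 * riemannZeta 3 ^ 2) ∧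
    (∀ ω : ℂ, ω = Complex.exp (2 * (Real.pi : ℂ) * Complex.I / 6) →
      nielsenPolylog 3 3 ω =
        3 * classicalPolylog 6 ω
          - 1 / 2 * riemannZeta 3 ^ 2
          - 1829 / 1944 * riemannZeta 6
          + 1 / 3 * Complex.I * (Real.pi : ℂ) * (nielsenPolylog 3 2 ω - 2 * riemannZeta 5)
          + 1 / 3 * riemannZeta 2 * classicalPolylog 4 ω
          + 1 / 324 * (2 * Complex.I * (Real.pi : ℂ)) ^ 3 * riemannZeta 3) := by
  refine ⟨nielsenPolylog_three_three_neg_one, ?_⟩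
  rintro ω rfl
  exact nielsenPolylog_three_three_sixthRoot
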